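/- Let $\mathbb D\subset\mathbb C$ be the open unit disk and $\mathbb S=\partial\mathbb D$. There exists a homeomorphism $\varphi\colon\mathbb S\to\mathbb S$ (onto) which satisfies the bi-Douglas condition \[ \int_{\mathbb S}\int_{\mathbb S}\left(\left|\frac{\varphi(\xi)-\varphi(\eta)}{\xi-\eta}\right|^2+\left|\frac{\varphi^{-1}(\xi)-\varphi^{-1}(\eta)}{\xi-\eta}\right|^2\right)|d\xi|\,|d\eta|<\infty \] and whose harmonic extension $h$ (the continuous function on $\overline{\mathbb D}$ that is harmonic in $\mathbb D$ and equals $\varphi$ on $\mathbb S$) is a homeomorphism of $\overline{\mathbb D}$ onto itself, mapping $\mathbb D$ onto $\mathbb D$, whose inverse $h^{-1}\colon\mathbb D\to\mathbb D$ does not belong to the Sobolev space $W^{1,2}(\mathbb D,\mathbb C)$. Moreover, $\varphi$ can be chosen so that, in addition, $t\mapsto\varphi(e^{it})$ is $C^\infty$ on $\mathbb R$; $\varphi$ has a flat point, i.e. there is $\theta\in\mathbb R$ such that $\varphi(e^{it})-\varphi(e^{i\theta})=O(|t-\theta|^n)$ as $t\to\theta$ for every $n\in\mathbb N$; the Jacobian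 $J_h$ is positive everywhere in $\mathbb D$; and the distortion $K_h=|Dh|^2/J_h$ (with $|Dh|$ the operator norm of the differential) is not in $L^1(\mathbb D)$. -/

import Mathlib

open Set Metric MeasureTheory Asymptotics
open scoped Topology ContDiff ENNReal

/-- The bi-Douglas condition for a homeomorphism `φ` of the unit circle, with respect to arc length
`|dξ| |dη|` (both circle variables are parametrised by angle, `ξ = exp (i s)`, `η = exp (i t)`). The
integrand is nonnegative, so the double integral is taken in `[0, ∞]`; the diagonal is a null set. -/
def BiDouglas (φ : Circle ≃ₜ Circle) : Prop :=
  ∫⁻ s in Ioc (0 : ℝ) (2 * Real.pi), ∫⁻ t in Ioc (0 : ℝ) (2 * Real.pi),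
    (‖((φ (Circle.exp s) : ℂ) - φ (Circle.exp t)) / ((Circle.exp s : ℂ) - Circle.exp t)‖ₑ ^ 2 +
     ‖((φ.symm (Circle.exp s) : ℂ) - φ.symm (Circle.exp t)) /
        ((Circle.exp s : ℂ) - Circle.exp t)‖ₑ ^ 2) < ⊤

/-- `h` is (on the closed unit disc) the harmonic extension of the circle map `φ`, that is, the
unique solution of the Dirichlet problem with boundary values `φ`. -/
structure IsHarmonicExtension (φ : Circle → Circle) (h : ℂ → ℂ) : Prop where
  continuousOn : ContinuousOn h (closedBall 0 1)
  harmonic : InnerProductSpace.HarmonicOnNhd h (ball 0 1)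
  boundary : ∀ ξ : Circle, h ξ = φ ξ

/-- `g` is a weak differential of `f` on the open set `Ω ⊆ ℂ`: for every real test function
`ψ ∈ C_c^∞(Ω)` and every direction `v`, `∫_Ω (∂_v ψ) f = - ∫_Ω ψ (g · v)`. -/
def IsWeakDifferential (Ω : Set ℂ) (f : ℂ → ℂ) (g : ℂ → ℂ →L[ℝ] ℂ) : Prop :=
  ∀ ψ : ℂ → ℝ, ContDiff ℝ ∞ ψ → HasCompactSupport ψ → tsupport ψ ⊆ Ω → ∀ v : ℂ,
    ∫ z in Ω, fderiv ℝ ψ z v • f z = - ∫ z in Ω, ψ z • g z v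

/-- The Sobolev space `W^{1,p}(Ω, ℂ)` of an open set `Ω ⊆ ℂ`: `f ∈ L^p(Ω)`, and `f` has a weak
differential in `L^p(Ω)`. -/
def MemSobolevOne (p : ℝ≥0∞) (Ω : Set ℂ) (f : ℂ → ℂ) : Prop :=
  MemLp f p (volume.restrict Ω) ∧
    ∃ g : ℂ → ℂ →L[ℝ] ℂ, MemLp g p (volume.restrict Ω) ∧ IsWeakDifferential Ω f g

/-- The Jacobian determinant `J_h`. -/
noncomputable def jacobianDet (h : ℂ → ℂ) (z : ℂ) : ℝ := (fderiv ℝ h z).det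

/-- The distortion `K_h = |Dh|² / J_h` (operator norm) of a differentiable map, at points where
`J_h > 0`. -/
noncomputable def distortion (h : ℂ → ℂ) (z : ℂ) : ℝ := ‖fderiv ℝ h z‖ ^ 2 / jacobianDet h z

/-- A trigonometric polynomial of degree one that vanishes at two points, in product form. -/
lemma cos_sub_mid_sub_cos (θ a b : ℝ) :
    Real.cos (θ - (a + b) / 2) - Real.cos ((b - a) / 2) =
      -2 * Real.sin ((θ - a) / 2) * Real.sin ((θ - b) / 2) := by
  rw [Real.cos_sub_cos]
  congr 2
  · congr 2; ring_nf
  · ring_nf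

/-- Orientation: a degree one circle map preserves the sign pattern of the chord function. -/
lemma chord_mul_chord_nonneg {u : ℝ → ℝ} (hmono : Monotone u)
    (hper : ∀ t, u (t + 2 * Real.pi) = u t + 2 * Real.pi) {a b t : ℝ} (hab : a ≤ b)
    (hb : b ≤ a + 2 * Real.pi) (hat : a ≤ t) (hta : t ≤ a + 2 * Real.pi) :
    0 ≤ (Real.sin ((t - a) / 2) * Real.sin ((t - b) / 2)) *
      (Real.sin ((u t - u a) / 2) * Real.sin ((u t - u b) / 2)) := by
  have h1 : u a ≤ u t := hmono hat
  have h2 : u t ≤ u a + 2 * Real.pi := hper a ▸ hmono hta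
  have h3 : u a ≤ u b := hmono hab
  have h4 : u b ≤ u a + 2 * Real.pi := hper a ▸ hmono hb
  have s1 : 0 ≤ Real.sin ((t - a) / 2) :=
    Real.sin_nonneg_of_nonneg_of_le_pi (by linarith) (by linarith)
  have s2 : 0 ≤ Real.sin ((u t - u a) / 2) :=
    Real.sin_nonneg_of_nonneg_of_le_pi (by linarith) (by linarith)
  have key : 0 ≤ Real.sin ((t - b) / 2) * Real.sin ((u t - u b) / 2) := by
    rcases le_total t b with h | h
    · have h5 : u t ≤ u b := hmono h
      exact mul_nonneg_of_nonpos_of_nonpos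
        (Real.sin_nonpos_of_nonpos_of_neg_pi_le (by linarith) (by linarith))
        (Real.sin_nonpos_of_nonpos_of_neg_pi_le (by linarith) (by linarith))
    · have h5 : u b ≤ u t := hmono h
      exact mul_nonneg (Real.sin_nonneg_of_nonneg_of_le_pi (by linarith) (by linarith))
        (Real.sin_nonneg_of_nonneg_of_le_pi (by linarith) (by linarith))
  calc (0 : ℝ) ≤ (Real.sin ((t - a) / 2) * Real.sin ((u t - u a) / 2)) *
      (Real.sin ((t - b) / 2) * Real.sin ((u t - u b) / 2)) := mul_nonneg (mul_nonneg s1 s2) key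
    _ = _ := by ring

lemma trigPoly_integral_pos {w : ℝ → ℝ} (hw : Continuous w) (hwp : ∀ t, 0 < w t) {A B C : ℝ}
    (hA : 0 < A) (h : ∀ t, 0 ≤ A + (B * Real.cos t + C * Real.sin t)) :
    0 < ∫ t in (0 : ℝ)..2 * Real.pi, w t * (A + (B * Real.cos t + C * Real.sin t)) := by
  refine intervalIntegral.integral_pos (by positivity) (by fun_prop)
    (fun t _ => mul_nonneg (hwp t).le (h t)) ?_
  by_cases hB : 0 ≤ B
  · exact ⟨0, ⟨le_rfl, by positivity⟩, mul_pos (hwp 0) (by simp; linarith)⟩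
  · refine ⟨Real.pi, ⟨by positivity, by linarith [Real.pi_pos]⟩, mul_pos (hwp _) ?_⟩
    simp only [Real.cos_pi, Real.sin_pi]
    linarith

/-- **Chebyshev system argument** behind the Radó–Kneser–Choquet theorem: a trigonometric
polynomial of degree one which, with a positive weight, is orthogonal to `1`, `cos ∘ u` and
`sin ∘ u`, where `u` is a degree one circle homeomorphism, vanishes identically. -/
theorem trigPoly_eq_zero_of_orthogonal {u w : ℝ → ℝ} (hu : Continuous u) (hmono : StrictMono u)
    (hper : ∀ t, u (t + 2 * Real.pi) = u t + 2 * Real.pi) (hw : Continuous w)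
    (hwp : ∀ t, 0 < w t) (hwper : Function.Periodic w (2 * Real.pi)) {A B C : ℝ}
    (h0 : ∫ t in (0 : ℝ)..2 * Real.pi, w t * (A + (B * Real.cos t + C * Real.sin t)) = 0)
    (hc : ∫ t in (0 : ℝ)..2 * Real.pi,
      w t * (A + (B * Real.cos t + C * Real.sin t)) * Real.cos (u t) = 0)
    (hs : ∫ t in (0 : ℝ)..2 * Real.pi,
      w t * (A + (B * Real.cos t + C * Real.sin t)) * Real.sin (u t) = 0) :
    A = 0 ∧ B = 0 ∧ C = 0 := by
  have hpi := Real.pi_pos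
  set ρ := ‖(⟨B, C⟩ : ℂ)‖ with hρ
  set β := Complex.arg ⟨B, C⟩ with hβ
  have hBr : B = ρ * Real.cos β := (Complex.norm_mul_cos_arg (⟨B, C⟩ : ℂ)).symm
  have hCr : C = ρ * Real.sin β := (Complex.norm_mul_sin_arg (⟨B, C⟩ : ℂ)).symm
  have hk : ∀ t, B * Real.cos t + C * Real.sin t = ρ * Real.cos (t - β) := by
    intro t; rw [Real.cos_sub, hBr, hCr]; ring
  have hkabs : ∀ t, |B * Real.cos t + C * Real.sin t| ≤ ρ := by
    intro t
    rw [hk, abs_mul, abs_of_nonneg (norm_nonneg _)]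
    exact mul_le_of_le_one_right (norm_nonneg _) (Real.abs_cos_le_one _)
  have hA1 : ¬ (0 < A ∧ ρ ≤ A) := by
    rintro ⟨hA, hρA⟩
    refine (trigPoly_integral_pos hw hwp hA fun t => ?_).ne' h0
    linarith [neg_le_of_abs_le (hkabs t)]
  have hA2 : ¬ (A < 0 ∧ ρ ≤ -A) := by
    rintro ⟨hA, hρA⟩
    refine (trigPoly_integral_pos (A := -A) (B := -B) (C := -C) hw hwp (by linarith)
      fun t => ?_).ne' ?_
    · linarith [le_of_abs_le (hkabs t)]
    · have h0' := congrArg Neg.neg h0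
      rw [neg_zero, ← intervalIntegral.integral_neg] at h0'
      rw [← h0']
      congr 1; ext t; ring
  by_cases hρ0 : ρ = 0
  · have hB0 : B = 0 := by rw [hBr, hρ0, zero_mul]
    have hC0 : C = 0 := by rw [hCr, hρ0, zero_mul]
    refine ⟨?_, hB0, hC0⟩
    rcases lt_trichotomy A 0 with h | h | h
    · exact absurd ⟨h, by linarith⟩ hA2
    · exact h
    · exact absurd ⟨h, by linarith⟩ hA1
  exfalso
  have hρp : 0 < ρ := lt_of_le_of_ne (norm_nonneg _) (Ne.symm hρ0)
  have hAρ : |A| < ρ := by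
    by_contra! hcon
    rcases lt_trichotomy A 0 with h | h | h
    · exact hA2 ⟨h, by rwa [abs_of_neg h] at hcon⟩
    · rw [h, abs_zero] at hcon; linarith
    · exact hA1 ⟨h, by rwa [abs_of_pos h] at hcon⟩
  obtain ⟨hAl, hAr⟩ := abs_lt.1 hAρ
  set γ := Real.arccos (-A / ρ) with hγ
  have hcosγ : A = -(ρ * Real.cos γ) := by
    rw [hγ, Real.cos_arccos]
    · field_simp
    · rw [le_div_iff₀ hρp]; linarith
    · rw [div_le_iff₀ hρp]; linarith
  have hγ0 : 0 < γ := by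
    rw [hγ, Real.arccos_pos, div_lt_iff₀ hρp]; linarith
  have hγπ : γ < Real.pi := by
    refine lt_of_le_of_ne (Real.arccos_le_pi _) fun h => ?_
    rw [h, Real.cos_pi] at hcosγ; linarith
  set a := β - γ
  set b := β + γ
  have hkprod : ∀ t, A + (B * Real.cos t + C * Real.sin t) =
      -2 * ρ * (Real.sin ((t - a) / 2) * Real.sin ((t - b) / 2)) := by
    intro t
    have := cos_sub_mid_sub_cos t a b
    rw [show (a + b) / 2 = β by simp only [a, b]; ring,
      show (b - a) / 2 = γ by simp only [a, b]; ring] at this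
    rw [hk, hcosγ]
    linear_combination ρ * this
  set F : ℝ → ℝ := fun t => w t * (A + (B * Real.cos t + C * Real.sin t)) *
    (Real.cos (u t - (u a + u b) / 2) - Real.cos ((u b - u a) / 2)) with hF
  have hFc : Continuous F := by fun_prop
  have hFper : Function.Periodic F (2 * Real.pi) := by
    intro t
    simp only [hF, hwper t, hper t, Real.cos_add_two_pi, Real.sin_add_two_pi]
    rw [show u t + 2 * Real.pi - (u a + u b) / 2 = (u t - (u a + u b) / 2) + 2 * Real.pi by ring,
      Real.cos_add_two_pi]
  have hFint : ∫ t in (0 : ℝ)..2 * Real.pi, F t = 0 := by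
    have : F = fun t =>
        Real.cos ((u a + u b) / 2) *
          (w t * (A + (B * Real.cos t + C * Real.sin t)) * Real.cos (u t)) +
        Real.sin ((u a + u b) / 2) *
          (w t * (A + (B * Real.cos t + C * Real.sin t)) * Real.sin (u t)) -
        Real.cos ((u b - u a) / 2) * (w t * (A + (B * Real.cos t + C * Real.sin t))) := by
      ext t; simp only [hF, Real.cos_sub (u t)]; ring
    rw [this, intervalIntegral.integral_sub, intervalIntegral.integral_add,
      intervalIntegral.integral_const_mul, intervalIntegral.integral_const_mul,
      intervalIntegral.integral_const_mul, h0, hc, hs]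
    · simp
    all_goals exact Continuous.intervalIntegrable (by fun_prop) _ _
  have hFint' : ∫ t in a..a + 2 * Real.pi, F t = 0 := by
    rw [hFper.intervalIntegral_add_eq a 0, zero_add, hFint]
  have hFform : ∀ t, F t = 4 * ρ * w t * ((Real.sin ((t - a) / 2) * Real.sin ((t - b) / 2)) *
      (Real.sin ((u t - u a) / 2) * Real.sin ((u t - u b) / 2))) := by
    intro t
    simp only [hF, hkprod, cos_sub_mid_sub_cos]
    ring
  refine (intervalIntegral.integral_pos (by linarith) hFc.continuousOn (fun t ht => ?_)
    ⟨β, ⟨by simp only [a]; linarith, by simp only [a]; linarith⟩, ?_⟩).ne' hFint'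
  · rw [hFform]
    exact mul_nonneg (by have := hwp t; positivity) (chord_mul_chord_nonneg hmono.monotone hper
      (by simp only [a, b]; linarith) (by simp only [a, b]; linarith) ht.1.le ht.2)
  · have h1 : u a < u β := hmono (by simp only [a]; linarith)
    have h2 : u β < u b := hmono (by simp only [b]; linarith)
    have h3 : u b < u a + 2 * Real.pi := hper a ▸ hmono (by simp only [a, b]; linarith)
    rw [hFform]
    have s1 : 0 < Real.sin ((β - a) / 2) :=
      Real.sin_pos_of_pos_of_lt_pi (by simp only [a]; linarith) (by simp only [a]; linarith)
    have s2 : Real.sin ((β - b) / 2) < 0 :=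
      Real.sin_neg_of_neg_of_neg_pi_lt (by simp only [b]; linarith) (by simp only [b]; linarith)
    have s3 : 0 < Real.sin ((u β - u a) / 2) :=
      Real.sin_pos_of_pos_of_lt_pi (by linarith) (by linarith)
    have s4 : Real.sin ((u β - u b) / 2) < 0 :=
      Real.sin_neg_of_neg_of_neg_pi_lt (by linarith) (by linarith)
    have := hwp β
    exact mul_pos (by positivity)
      (mul_pos_of_neg_of_neg (mul_neg_of_pos_of_neg s1 s2) (mul_neg_of_pos_of_neg s3 s4))

/-- The Poisson extension of `f` from the unit circle to the closed unit disc. -/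
noncomputable def poissonExt (f : ℂ → ℂ) (z : ℂ) : ℂ :=
  if ‖z‖ < 1 then Real.circleAverage (fun ζ => poissonKernel 0 z ζ • f ζ) 0 1 else f z

lemma poissonExt_of_mem_ball {f : ℂ → ℂ} {z : ℂ} (hz : z ∈ ball (0 : ℂ) 1) :
    poissonExt f z = Real.circleAverage (fun ζ => poissonKernel 0 z ζ • f ζ) 0 1 :=
  if_pos (by simpa using hz)

lemma poissonExt_of_one_le_norm {f : ℂ → ℂ} {z : ℂ} (hz : 1 ≤ ‖z‖) : poissonExt f z = f z :=
  if_neg (not_lt.2 hz)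

lemma CircleIntegrable.conj {f : ℂ → ℂ} (hf : CircleIntegrable f 0 1) :
    CircleIntegrable (fun ζ => starRingEnd ℂ (f ζ)) 0 1 := by
  simp only [CircleIntegrable, intervalIntegrable_iff] at hf ⊢
  exact Complex.conjCLE.toContinuousLinearMap.integrable_comp hf

lemma circleAverage_re_smul {k f : ℂ → ℂ} (h1 : CircleIntegrable (fun ζ => k ζ • f ζ) 0 1)
    (h2 : CircleIntegrable (fun ζ => k ζ • starRingEnd ℂ (f ζ)) 0 1) :
    Real.circleAverage (fun ζ => (k ζ).re • f ζ) 0 1 =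
      (1 / 2 : ℂ) * (Real.circleAverage (fun ζ => k ζ • f ζ) 0 1 +
        starRingEnd ℂ (Real.circleAverage (fun ζ => k ζ • starRingEnd ℂ (f ζ)) 0 1)) := by
  have h3 : Real.circleAverage (fun ζ => starRingEnd ℂ (k ζ • starRingEnd ℂ (f ζ))) 0 1 =
      starRingEnd ℂ (Real.circleAverage (fun ζ => k ζ • starRingEnd ℂ (f ζ)) 0 1) :=
    Complex.conjCLE.toContinuousLinearMap.circleAverage_comp_comm h2
  rw [← h3, ← Real.circleAverage_fun_add h1 h2.conj, ← smul_eq_mul,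
    ← Real.circleAverage_fun_smul]
  congr 1
  ext ζ
  simp only [smul_eq_mul, map_mul, Complex.conj_conj, Complex.real_smul]
  rw [← add_mul, Complex.add_conj]
  push_cast; ring

lemma circleIntegrable_herglotz_smul {f : ℂ → ℂ} (hf : CircleIntegrable f 0 1) {z : ℂ}
    (hz : z ∈ ball (0 : ℂ) 1) :
    CircleIntegrable (fun ζ => herglotzRieszKernel 0 z ζ • f ζ) 0 1 := by
  have := hf.continuousOn_smul (continuousOn_herglotzRieszKernel_sphere (R := 1) hz)
  exact this

lemma poissonExt_eq_analytic_add_conj {f : ℂ → ℂ} (hf : CircleIntegrable f 0 1) {z : ℂ}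
    (hz : z ∈ ball (0 : ℂ) 1) :
    poissonExt f z =
      (1 / 2 : ℂ) * (Real.circleAverage (fun ζ => herglotzRieszKernel 0 z ζ • f ζ) 0 1 +
        starRingEnd ℂ (Real.circleAverage
          (fun ζ => herglotzRieszKernel 0 z ζ • starRingEnd ℂ (f ζ)) 0 1)) := by
  rw [poissonExt_of_mem_ball hz, ← circleAverage_re_smul (circleIntegrable_herglotz_smul hf hz)
    (circleIntegrable_herglotz_smul hf.conj hz), poissonKernel_eq_re_herglotzRieszKernel]
  rfl

lemma harmonicOnNhd_poissonExt {f : ℂ → ℂ} (hf : CircleIntegrable f 0 1) :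
    InnerProductSpace.HarmonicOnNhd (poissonExt f) (ball 0 1) := by
  intro z hz
  have h1 := (analyticOnNhd_circleAverage_herglotzRieszKernel_smul hf z hz).harmonicAt
  have h2 := (analyticOnNhd_circleAverage_herglotzRieszKernel_smul hf.conj z hz).harmonicAt_conj
  have h3 := (h1.add h2).const_smul (c := (1 / 2 : ℝ))
  refine (InnerProductSpace.harmonicAt_congr_nhds ?_).2 h3
  filter_upwards [isOpen_ball.mem_nhds hz] with w hw
  rw [poissonExt_eq_analytic_add_conj hf hw]
  simp only [Pi.smul_apply, Pi.add_apply, Complex.real_smul]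
  push_cast
  rfl

lemma fderiv_poissonExt {f : ℂ → ℂ} (hf : CircleIntegrable f 0 1) {z : ℂ}
    (hz : z ∈ ball (0 : ℂ) 1) (v : ℂ) :
    fderiv ℝ (poissonExt f) z v =
      Real.circleAverage (fun ζ => (2 * ζ * v / (ζ - z) ^ 2).re • f ζ) 0 1 := by
  have h1 := hasDerivAt_circleAverage_herglotzRieszKernel_smul hf hz
  have h2 := hasDerivAt_circleAverage_herglotzRieszKernel_smul hf.conj hz
  have h1' := h1.hasFDerivAt.restrictScalars ℝ
  have h2' := Complex.conjCLE.toContinuousLinearMap.hasFDerivAt.comp z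
    (h2.hasFDerivAt.restrictScalars ℝ)
  have h3 := (h1'.add h2').const_smul (1 / 2 : ℝ)
  have h4 := h3.congr_of_eventuallyEq (f₁ := poissonExt f) (by
    filter_upwards [isOpen_ball.mem_nhds hz] with w hw
    rw [poissonExt_eq_analytic_add_conj hf hw]
    simp only [Pi.smul_apply, Pi.add_apply, Complex.real_smul]
    push_cast
    rfl)
  have hker : ContinuousOn (fun ζ : ℂ => 2 * ζ * v / (ζ - z) ^ 2) (sphere 0 |1|) := by
    refine ContinuousOn.div (by fun_prop) (by fun_prop) fun ζ hζ => pow_ne_zero _ ?_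
    rw [sub_ne_zero]; rintro rfl
    simp only [abs_one, mem_sphere_iff_norm, sub_zero, mem_ball] at hζ hz
    simp [hζ] at hz
  have e : ∀ g : ℂ → ℂ, v * Real.circleAverage (fun ζ => (2 * ζ / (ζ - z) ^ 2) • g ζ) 0 1 =
      Real.circleAverage (fun ζ => (2 * ζ * v / (ζ - z) ^ 2) • g ζ) 0 1 := by
    intro g
    rw [← smul_eq_mul, ← Real.circleAverage_fun_smul]
    congr 1; ext ζ; simp only [smul_eq_mul]; ring
  rw [h4.fderiv, circleAverage_re_smul (hf.continuousOn_smul hker) (hf.conj.continuousOn_smul hker),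
    ← e, ← e]
  simp [ContinuousLinearMap.comp_apply, Complex.real_smul]
  ring

/-- A continuous periodic function is bounded. -/
lemma Function.Periodic.exists_norm_le {E : Type*} [NormedAddCommGroup E] {G : ℝ → E} {T : ℝ}
    (hT : T ≠ 0) (hp : Function.Periodic G T) (hc : Continuous G) : ∃ M, 0 ≤ M ∧ ∀ t, ‖G t‖ ≤ M := by
  obtain ⟨M, hM⟩ := (hp.isBounded_of_continuous hT hc).exists_norm_le
  exact ⟨M, (norm_nonneg _).trans (hM _ (mem_range_self 0)), fun t => hM _ (mem_range_self t)⟩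

lemma sq_le_one_sub_cos {x : ℝ} (hx : |x| ≤ Real.pi) :
    x ^ 2 ≤ Real.pi ^ 2 / 2 * (1 - Real.cos x) := by
  have h := Real.cos_le_one_sub_mul_cos_sq hx
  have hpi := Real.pi_pos
  have : 2 / Real.pi ^ 2 * x ^ 2 ≤ 1 - Real.cos x := by linarith
  calc x ^ 2 = Real.pi ^ 2 / 2 * (2 / Real.pi ^ 2 * x ^ 2) := by field_simp
    _ ≤ _ := by gcongr

/-- Every real number is congruent modulo `2π` to a number in `[-π, π]`. -/
lemma exists_abs_le_pi_add_int_mul (x : ℝ) : ∃ y : ℝ, ∃ n : ℤ, |y| ≤ Real.pi ∧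
    x = y + n * (2 * Real.pi) := by
  refine ⟨toIocMod Real.two_pi_pos (-Real.pi) x, toIocDiv Real.two_pi_pos (-Real.pi) x, ?_, ?_⟩
  · have h := toIocMod_mem_Ioc Real.two_pi_pos (-Real.pi) x
    rw [abs_le]
    exact ⟨h.1.le, by linarith [h.2]⟩
  · have := toIocMod_add_toIocDiv_zsmul Real.two_pi_pos (-Real.pi) x
    rw [zsmul_eq_mul] at this
    exact this.symm

lemma Function.Periodic.deriv' {E : Type*} [NormedAddCommGroup E] [NormedSpace ℝ E] {G : ℝ → E}
    {T : ℝ} (hp : Function.Periodic G T) : Function.Periodic (deriv G) T := by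
  intro t
  rw [← deriv_comp_add_const]
  congr 1
  exact funext hp

/-- Second order trigonometric Taylor estimate for periodic functions. -/
lemma exists_norm_sub_sin_smul_deriv_le {E : Type*} [NormedAddCommGroup E] [NormedSpace ℝ E]
    {G : ℝ → E} (hG : ContDiff ℝ 2 G) (hp : Function.Periodic G (2 * Real.pi)) :
    ∃ M, 0 ≤ M ∧ ∀ t τ, ‖G (t + τ) - G t - Real.sin τ • deriv G t‖ ≤ M * (1 - Real.cos τ) := by
  have hG1 : ContDiff ℝ 1 (deriv G) := by
    have : ContDiff ℝ (1 + 1) G := by exact_mod_cast hG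
    exact (contDiff_succ_iff_deriv.1 this).2.2
  have hd0 : Differentiable ℝ G := hG.differentiable (by norm_num)
  have hd1 : Differentiable ℝ (deriv G) := hG1.differentiable (by norm_num)
  have hc2 : Continuous (deriv (deriv G)) := hG1.continuous_deriv (by norm_num)
  obtain ⟨M1, hM1, h1⟩ := hp.deriv'.exists_norm_le Real.two_pi_pos.ne' hG1.continuous
  obtain ⟨M2, hM2, h2⟩ := hp.deriv'.deriv'.exists_norm_le Real.two_pi_pos.ne' hc2
  set M := M1 + M2
  refine ⟨M * (Real.pi ^ 2 / 2), by positivity, fun t x => ?_⟩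
  obtain ⟨τ, n, hτ, rfl⟩ := exists_abs_le_pi_add_int_mul x
  have e1 : G (t + (τ + n * (2 * Real.pi))) = G (t + τ) := by
    rw [← add_assoc]; exact hp.int_mul n _
  rw [e1, Real.sin_add_int_mul_two_pi, Real.cos_add_int_mul_two_pi]
  have D1 : ∀ s, HasDerivAt (fun s => deriv G (t + s) - Real.cos s • deriv G t)
      (deriv (deriv G) (t + s) + Real.sin s • deriv G t) s := by
    intro s
    have a := (hd1 (t + s)).hasDerivAt.comp_const_add t s
    have b := (Real.hasDerivAt_cos s).smul_const (deriv G t)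
    have c := a.sub b
    rw [neg_smul, sub_neg_eq_add] at c
    exact c
  have B1 : ∀ s, ‖deriv G (t + s) - Real.cos s • deriv G t‖ ≤ M * |s| := by
    intro s
    have := (convex_univ (𝕜 := ℝ) (E := ℝ)).norm_image_sub_le_of_norm_hasDerivWithin_le
      (C := M) (fun y _ => (D1 y).hasDerivWithinAt) (fun y _ => ?_) (mem_univ 0) (mem_univ s)
    · simpa using this
    · refine (norm_add_le _ _).trans ?_
      rw [norm_smul, add_comm]
      refine add_le_add ?_ (h2 _)
      exact (mul_le_of_le_one_left (norm_nonneg _) (Real.abs_sin_le_one _)).trans (h1 _)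
  have D0 : ∀ s, HasDerivAt (fun s => G (t + s) - G t - Real.sin s • deriv G t)
      (deriv G (t + s) - Real.cos s • deriv G t) s := by
    intro s
    have a := (hd0 (t + s)).hasDerivAt.comp_const_add t s
    have b := (Real.hasDerivAt_sin s).smul_const (deriv G t)
    exact (a.sub_const _).sub b
  have B0 : ‖G (t + τ) - G t - Real.sin τ • deriv G t‖ ≤ M * τ ^ 2 := by
    have := (convex_uIcc 0 τ).norm_image_sub_le_of_norm_hasDerivWithin_le
      (C := M * |τ|) (fun y _ => (D0 y).hasDerivWithinAt) (fun y hy => (B1 y).trans ?_)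
      left_mem_uIcc right_mem_uIcc
    · simp only [add_zero, sub_self, Real.sin_zero, zero_smul, sub_zero, Real.norm_eq_abs] at this
      rwa [mul_assoc, abs_mul_abs_self, ← sq] at this
    · have : |y| ≤ |τ| := by simpa using abs_sub_left_of_mem_uIcc hy
      gcongr
  calc _ ≤ M * τ ^ 2 := B0
    _ ≤ M * (Real.pi ^ 2 / 2 * (1 - Real.cos τ)) := by gcongr; exact sq_le_one_sub_cos hτ
    _ = _ := by ring

/-- The Poisson kernel of the disc in polar form. -/
noncomputable def poissonPolar (r τ : ℝ) : ℝ :=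
  (1 - r ^ 2) / ((1 - r) ^ 2 + 2 * r * (1 - Real.cos τ))

lemma poissonPolar_denom_pos {r : ℝ} (h0 : 0 ≤ r) (h1 : r < 1) (τ : ℝ) :
    0 < (1 - r) ^ 2 + 2 * r * (1 - Real.cos τ) := by
  have := Real.cos_le_one τ
  have h2 : 0 < (1 - r) ^ 2 := pow_pos (by linarith) 2
  have h3 : 0 ≤ 2 * r * (1 - Real.cos τ) := mul_nonneg (by linarith) (by linarith)
  linarith

lemma poissonPolar_pos {r : ℝ} (h0 : 0 ≤ r) (h1 : r < 1) (τ : ℝ) : 0 < poissonPolar r τ :=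
  div_pos (by nlinarith) (poissonPolar_denom_pos h0 h1 τ)

lemma continuous_poissonPolar {r : ℝ} (h0 : 0 ≤ r) (h1 : r < 1) : Continuous (poissonPolar r) :=
  Continuous.div (by fun_prop) (by fun_prop) fun τ => (poissonPolar_denom_pos h0 h1 τ).ne'

lemma normSq_circleMap_sub (r t τ : ℝ) :
    Complex.normSq (circleMap 0 1 (τ + t) - circleMap 0 r t) =
      (1 - r) ^ 2 + 2 * r * (1 - Real.cos τ) := by
  rw [circleMap_zero, circleMap_zero, Complex.ofReal_add, add_mul, Complex.exp_add,
    show ((1 : ℝ) : ℂ) * (Complex.exp (τ * Complex.I) * Complex.exp (t * Complex.I)) -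
      r * Complex.exp (t * Complex.I) =
      (Complex.exp (τ * Complex.I) - r) * Complex.exp (t * Complex.I) by push_cast; ring,
    Complex.normSq_mul, Complex.normSq_eq_norm_sq (Complex.exp (t * Complex.I)),
    Complex.norm_exp_ofReal_mul_I, Complex.normSq_apply]
  simp only [Complex.sub_re, Complex.exp_ofReal_mul_I_re, Complex.ofReal_re, Complex.sub_im,
    Complex.exp_ofReal_mul_I_im, Complex.ofReal_im]
  nlinarith [Real.sin_sq_add_cos_sq τ]

lemma poissonKernel_circleMap (r t τ : ℝ) :
    poissonKernel 0 (circleMap 0 r t) (circleMap 0 1 (τ + t)) = poissonPolar r τ := by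
  rw [poissonKernel_def, sub_zero, sub_zero, ← Complex.normSq_eq_norm_sq (_ - _),
    normSq_circleMap_sub, norm_circleMap_zero, norm_circleMap_zero, poissonPolar]
  simp

lemma circleMap_mem_ball_one {r : ℝ} (h0 : 0 ≤ r) (h1 : r < 1) (t : ℝ) :
    circleMap 0 r t ∈ ball (0 : ℂ) 1 := by
  simp [abs_of_nonneg h0, h1]

lemma poissonExt_circleMap (f : ℂ → ℂ) {r : ℝ} (h0 : 0 ≤ r) (h1 : r < 1) (t : ℝ) :
    poissonExt f (circleMap 0 r t) = (2 * Real.pi)⁻¹ •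
      ∫ τ in (0 : ℝ)..2 * Real.pi, poissonPolar r τ • f (circleMap 0 1 (t + τ)) := by
  rw [poissonExt_of_mem_ball (circleMap_mem_ball_one h0 h1 t), Real.circleAverage_eq_integral_add t]
  simp only [poissonKernel_circleMap, add_comm t]

lemma poissonExt_id {z : ℂ} (hz : z ∈ ball (0 : ℂ) 1) : poissonExt id z = z := by
  rw [poissonExt_of_mem_ball hz]
  exact DiffContOnCl.circleAverage_poissonKernel_smul (f := id)
    (differentiable_id.diffContOnCl) hz

lemma poissonExt_one {z : ℂ} (hz : z ∈ ball (0 : ℂ) 1) : poissonExt 1 z = 1 := by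
  rw [poissonExt_of_mem_ball hz]
  exact DiffContOnCl.circleAverage_poissonKernel_smul (f := 1)
    ((differentiable_const (1 : ℂ)).diffContOnCl) hz

lemma integral_poissonPolar {r : ℝ} (h0 : 0 ≤ r) (h1 : r < 1) :
    ∫ τ in (0 : ℝ)..2 * Real.pi, poissonPolar r τ = 2 * Real.pi := by
  have h := poissonExt_circleMap 1 h0 h1 0
  rw [poissonExt_one (circleMap_mem_ball_one h0 h1 0)] at h
  simp only [Pi.one_apply, Complex.real_smul, mul_one, intervalIntegral.integral_ofReal] at h
  have h' : (1 : ℝ) = (2 * Real.pi)⁻¹ * ∫ τ in (0 : ℝ)..2 * Real.pi, poissonPolar r τ := by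
    exact_mod_cast h
  field_simp at h'
  linarith

lemma integral_poissonPolar_mul_exp {r : ℝ} (h0 : 0 ≤ r) (h1 : r < 1) :
    ∫ τ in (0 : ℝ)..2 * Real.pi, (poissonPolar r τ : ℂ) * Complex.exp (τ * Complex.I) =
      2 * Real.pi * r := by
  have h := poissonExt_circleMap id h0 h1 0
  rw [poissonExt_id (circleMap_mem_ball_one h0 h1 0)] at h
  simp only [id_eq, Complex.real_smul, circleMap_zero, zero_add, Complex.ofReal_zero, zero_mul,
    Complex.exp_zero, mul_one, Complex.ofReal_one, one_mul] at h
  rw [h, ← mul_assoc]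
  push_cast
  rw [mul_inv_cancel₀ (by simp), one_mul]

lemma integral_poissonPolar_mul_cos {r : ℝ} (h0 : 0 ≤ r) (h1 : r < 1) :
    ∫ τ in (0 : ℝ)..2 * Real.pi, poissonPolar r τ * Real.cos τ = 2 * Real.pi * r := by
  have hP := continuous_poissonPolar h0 h1
  have h := congrArg Complex.reCLM (integral_poissonPolar_mul_exp h0 h1)
  rw [← ContinuousLinearMap.intervalIntegral_comp_comm _
    (Continuous.intervalIntegrable (by fun_prop) _ _)] at h
  simpa [Complex.exp_ofReal_mul_I_re] using h

lemma integral_poissonPolar_mul_sin {r : ℝ} (h0 : 0 ≤ r) (h1 : r < 1) :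
    ∫ τ in (0 : ℝ)..2 * Real.pi, poissonPolar r τ * Real.sin τ = 0 := by
  have hP := continuous_poissonPolar h0 h1
  have h := congrArg Complex.imCLM (integral_poissonPolar_mul_exp h0 h1)
  rw [← ContinuousLinearMap.intervalIntegral_comp_comm _
    (Continuous.intervalIntegrable (by fun_prop) _ _)] at h
  simpa [Complex.exp_ofReal_mul_I_im] using h

/-- Quantitative convergence of the Poisson means of a `C²` periodic function. -/
lemma norm_poissonPolar_mean_sub_le {E : Type*} [NormedAddCommGroup E] [NormedSpace ℝ E]
    [CompleteSpace E] {G : ℝ → E} (hGc : Continuous G) {M t : ℝ} {D : E}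
    (hM : ∀ τ, ‖G (t + τ) - G t - Real.sin τ • D‖ ≤ M * (1 - Real.cos τ))
    {r : ℝ} (h0 : 0 ≤ r) (h1 : r < 1) :
    ‖(2 * Real.pi)⁻¹ • (∫ τ in (0 : ℝ)..2 * Real.pi, poissonPolar r τ • G (t + τ)) - G t‖ ≤
      M * (1 - r) := by
  have hP := continuous_poissonPolar h0 h1
  have hpi := Real.pi_pos
  have e : (∫ τ in (0 : ℝ)..2 * Real.pi,
      poissonPolar r τ • (G (t + τ) - G t - Real.sin τ • D)) =
      (∫ τ in (0 : ℝ)..2 * Real.pi, poissonPolar r τ • G (t + τ)) - (2 * Real.pi) • G t := by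
    have e1 : ∀ τ, poissonPolar r τ • (G (t + τ) - G t - Real.sin τ • D) =
        poissonPolar r τ • G (t + τ) - poissonPolar r τ • G t -
          (poissonPolar r τ * Real.sin τ) • D := by
      intro τ; rw [smul_sub, smul_sub, smul_smul]
    simp only [e1]
    rw [intervalIntegral.integral_sub, intervalIntegral.integral_sub,
      intervalIntegral.integral_smul_const, intervalIntegral.integral_smul_const,
      integral_poissonPolar h0 h1, integral_poissonPolar_mul_sin h0 h1, zero_smul, sub_zero]
    all_goals exact Continuous.intervalIntegrable (by fun_prop) _ _
  have e2 : (2 * Real.pi)⁻¹ • (∫ τ in (0 : ℝ)..2 * Real.pi, poissonPolar r τ • G (t + τ)) - G t =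
      (2 * Real.pi)⁻¹ • ∫ τ in (0 : ℝ)..2 * Real.pi,
        poissonPolar r τ • (G (t + τ) - G t - Real.sin τ • D) := by
    rw [e, smul_sub, smul_smul, inv_mul_cancel₀ (by positivity), one_smul]
  rw [e2, norm_smul, Real.norm_of_nonneg (by positivity), inv_mul_le_iff₀ (by positivity)]
  calc _ ≤ ∫ τ in (0 : ℝ)..2 * Real.pi, poissonPolar r τ * (M * (1 - Real.cos τ)) := by
        refine intervalIntegral.norm_integral_le_of_norm_le (by positivity)
          (.of_forall fun τ _ => ?_) (Continuous.intervalIntegrable (by fun_prop) _ _)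
        rw [norm_smul, Real.norm_of_nonneg (poissonPolar_pos h0 h1 τ).le]
        exact mul_le_mul_of_nonneg_left (hM τ) (poissonPolar_pos h0 h1 τ).le
    _ = ∫ τ in (0 : ℝ)..2 * Real.pi,
          (M * poissonPolar r τ - M * (poissonPolar r τ * Real.cos τ)) := by
        congr 1; ext τ; ring
    _ = 2 * Real.pi * (M * (1 - r)) := by
        rw [intervalIntegral.integral_sub, intervalIntegral.integral_const_mul,
          intervalIntegral.integral_const_mul, integral_poissonPolar h0 h1,
          integral_poissonPolar_mul_cos h0 h1]
        · ring
        all_goals exact Continuous.intervalIntegrable (by fun_prop) _ _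

/-- Lifts to `ℝ` of orientation preserving `C²` homeomorphisms of the circle. -/
structure IsCircleLift (u : ℝ → ℝ) : Prop where
  contDiff : ContDiff ℝ 2 u
  strictMono : StrictMono u
  map_add_two_pi : ∀ t, u (t + 2 * Real.pi) = u t + 2 * Real.pi

/-- The circle map with lift `u`, extended to `ℂ` by homogeneity of degree zero. -/
noncomputable def liftMap (u : ℝ → ℝ) (z : ℂ) : ℂ := Complex.exp (u z.arg * Complex.I)

namespace IsCircleLift

variable {u : ℝ → ℝ}

lemma continuous (hu : IsCircleLift u) : Continuous u := hu.contDiff.continuous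

lemma differentiable (hu : IsCircleLift u) : Differentiable ℝ u :=
  hu.contDiff.differentiable (by norm_num)

lemma continuous_deriv (hu : IsCircleLift u) : Continuous (deriv u) :=
  hu.contDiff.continuous_deriv (by norm_num)

lemma map_add_int_mul (hu : IsCircleLift u) (t : ℝ) (n : ℤ) :
    u (t + n * (2 * Real.pi)) = u t + n * (2 * Real.pi) := by
  have hp : Function.Periodic (fun t => u t - t) (2 * Real.pi) := by
    intro t; simp only [hu.map_add_two_pi]; ring
  have : u (t + n * (2 * Real.pi)) - (t + n * (2 * Real.pi)) = u t - t := hp.int_mul n t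
  linarith

lemma periodic_exp (hu : IsCircleLift u) :
    Function.Periodic (fun t => Complex.exp (u t * Complex.I)) (2 * Real.pi) := by
  intro t
  simp only [hu.map_add_two_pi]
  rw [Complex.ofReal_add, add_mul, Complex.exp_add]
  push_cast
  rw [Complex.exp_two_pi_mul_I, mul_one]

lemma contDiff_exp (hu : IsCircleLift u) :
    ContDiff ℝ 2 (fun t => Complex.exp (u t * Complex.I)) := by
  have := hu.contDiff
  have h1 : ContDiff ℝ 2 (fun t => (u t : ℂ)) := Complex.ofRealCLM.contDiff.comp this
  exact (h1.mul contDiff_const).cexp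

lemma liftMap_circleMap (hu : IsCircleLift u) {r : ℝ} (hr : 0 < r) (t : ℝ) :
    liftMap u (circleMap 0 r t) = Complex.exp (u t * Complex.I) := by
  have h := hu.periodic_exp.int_mul (toIocDiv Real.two_pi_pos (-Real.pi) t)
    (toIocMod Real.two_pi_pos (-Real.pi) t)
  have h2 := toIocMod_add_toIocDiv_zsmul Real.two_pi_pos (-Real.pi) t
  rw [zsmul_eq_mul] at h2
  rw [h2] at h
  rw [liftMap, circleMap_zero, Complex.arg_real_mul _ hr, Complex.arg_exp_mul_I, h]

lemma circleIntegrable_liftMap (hu : IsCircleLift u) : CircleIntegrable (liftMap u) 0 1 := by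
  simp only [CircleIntegrable, hu.liftMap_circleMap one_pos]
  exact (hu.contDiff_exp.continuous).intervalIntegrable _ _

lemma harmonicOnNhd (hu : IsCircleLift u) :
    InnerProductSpace.HarmonicOnNhd (poissonExt (liftMap u)) (ball 0 1) :=
  harmonicOnNhd_poissonExt hu.circleIntegrable_liftMap

lemma poissonExt_boundary (hu : IsCircleLift u) (t : ℝ) :
    poissonExt (liftMap u) (circleMap 0 1 t) = Complex.exp (u t * Complex.I) := by
  rw [poissonExt_of_one_le_norm (by simp), hu.liftMap_circleMap one_pos]

lemma poissonExt_circleMap_eq (hu : IsCircleLift u) {r : ℝ} (h0 : 0 ≤ r) (h1 : r < 1) (t : ℝ) :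
    poissonExt (liftMap u) (circleMap 0 r t) = (2 * Real.pi)⁻¹ •
      ∫ τ in (0 : ℝ)..2 * Real.pi, poissonPolar r τ • Complex.exp (u (t + τ) * Complex.I) := by
  rw [poissonExt_circleMap _ h0 h1]
  simp only [hu.liftMap_circleMap one_pos]

lemma exists_norm_poissonExt_sub_le (hu : IsCircleLift u) : ∃ M, 0 ≤ M ∧
    ∀ r t, 0 ≤ r → r ≤ 1 →
      ‖poissonExt (liftMap u) (circleMap 0 r t) - Complex.exp (u t * Complex.I)‖ ≤
        M * (1 - r) := by
  obtain ⟨M, hM0, hM⟩ := exists_norm_sub_sin_smul_deriv_le hu.contDiff_exp hu.periodic_exp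
  refine ⟨M, hM0, fun r t h0 h1 => ?_⟩
  rcases h1.lt_or_eq with h1 | rfl
  · rw [hu.poissonExt_circleMap_eq h0 h1]
    exact norm_poissonPolar_mean_sub_le hu.contDiff_exp.continuous (hM t) h0 h1
  · simp [hu.poissonExt_boundary]

lemma continuousOn_poissonExt (hu : IsCircleLift u) :
    ContinuousOn (poissonExt (liftMap u)) (closedBall 0 1) := by
  intro z₀ hz₀
  rcases (mem_closedBall_zero_iff.1 hz₀).lt_or_eq with h | h
  · exact ((hu.harmonicOnNhd z₀ (by simpa using h)).1.continuousAt).continuousWithinAt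
  obtain ⟨M, hM0, hM⟩ := hu.exists_norm_poissonExt_sub_le
  have hz0 : z₀ ≠ 0 := by rintro rfl; simp at h
  set t₀ := z₀.arg
  have hz₀t : z₀ = Complex.exp (t₀ * Complex.I) := by
    have := Complex.norm_mul_exp_arg_mul_I z₀
    rw [h] at this; simpa using this.symm
  set T : ℂ → ℝ := fun z => (z / z₀).arg + t₀ with hT
  have hTc : ContinuousAt T z₀ := by
    refine ContinuousAt.add ?_ continuousAt_const
    refine ContinuousAt.comp (g := Complex.arg) ?_ (by fun_prop)
    rw [div_self hz0]
    exact Complex.continuousAt_arg (by simp [Complex.slitPlane])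
  have hT0 : T z₀ = t₀ := by simp [hT, div_self hz0]
  have hzT : ∀ z, z = circleMap 0 ‖z‖ (T z) := by
    intro z
    have h1 := Complex.norm_mul_exp_arg_mul_I (z / z₀)
    rw [norm_div, h, div_one] at h1
    rw [circleMap_zero, hT]
    simp only [Complex.ofReal_add, add_mul, Complex.exp_add]
    rw [← mul_assoc, h1, ← hz₀t, div_mul_cancel₀ _ hz0]
  have hval : poissonExt (liftMap u) z₀ = Complex.exp (u (T z₀) * Complex.I) := by
    have := hu.poissonExt_boundary t₀
    rwa [circleMap_zero, Complex.ofReal_one, one_mul, ← hz₀t, ← hT0] at this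
  have hbound : ∀ z ∈ closedBall (0 : ℂ) 1,
      ‖poissonExt (liftMap u) z - poissonExt (liftMap u) z₀‖ ≤ M * (1 - ‖z‖) +
        ‖Complex.exp (u (T z) * Complex.I) - Complex.exp (u (T z₀) * Complex.I)‖ := by
    intro z hz
    rw [hval]
    have h1 := hM ‖z‖ (T z) (norm_nonneg _) (mem_closedBall_zero_iff.1 hz)
    rw [← hzT] at h1
    refine (norm_sub_le_norm_sub_add_norm_sub _ (Complex.exp (u (T z) * Complex.I)) _).trans ?_
    gcongr
  rw [ContinuousWithinAt, tendsto_iff_norm_sub_tendsto_zero]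
  refine squeeze_zero' (.of_forall fun _ => norm_nonneg _)
    (Filter.eventually_of_mem self_mem_nhdsWithin hbound) ?_
  have hcont : ContinuousAt (fun z => M * (1 - ‖z‖) +
      ‖Complex.exp (u (T z) * Complex.I) - Complex.exp (u (T z₀) * Complex.I)‖) z₀ := by
    have : ContinuousAt (fun z => Complex.exp (u (T z) * Complex.I)) z₀ :=
      (hu.contDiff_exp.continuous.continuousAt (x := T z₀)).comp
        (f := T) hTc
    fun_prop
  have := hcont.tendsto
  simp only [h, sub_self, mul_zero, norm_zero, add_zero] at this
  exact this.mono_left nhdsWithin_le_nhds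

end IsCircleLift

lemma ContinuousLinearMap.det_complex (A : ℂ →L[ℝ] ℂ) :
    A.det = (A 1).re * (A Complex.I).im - (A 1).im * (A Complex.I).re := by
  rw [ContinuousLinearMap.det, ← LinearMap.det_toMatrix Complex.basisOneI, Matrix.det_fin_two]
  simp [LinearMap.toMatrix_apply, Complex.basisOneI]
  ring

lemma ContinuousLinearMap.det_ne_zero_of_injective {A : ℂ →L[ℝ] ℂ} (h : ∀ v, A v = 0 → v = 0) :
    A.det ≠ 0 := by
  intro h0
  have h1 : ⊥ < (A : ℂ →ₗ[ℝ] ℂ).ker := LinearMap.bot_lt_ker_of_det_eq_zero h0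
  obtain ⟨v, hv, hv0⟩ := Submodule.exists_mem_ne_zero_of_ne_bot h1.ne'
  exact hv0 (h v (by simpa using hv))

lemma normSq_exp_sub (z : ℂ) (θ : ℝ) :
    Complex.normSq (circleMap 0 1 θ - z) =
      1 + Complex.normSq z - 2 * (z.re * Real.cos θ + z.im * Real.sin θ) := by
  rw [circleMap_zero, Complex.ofReal_one, one_mul, Complex.normSq_apply, Complex.normSq_apply]
  simp only [Complex.sub_re, Complex.exp_ofReal_mul_I_re, Complex.sub_im,
    Complex.exp_ofReal_mul_I_im]
  nlinarith [Real.sin_sq_add_cos_sq θ]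

lemma normSq_exp_sub_pos {z : ℂ} (hz : z ∈ ball (0 : ℂ) 1) (θ : ℝ) :
    0 < Complex.normSq (circleMap 0 1 θ - z) := by
  rw [Complex.normSq_pos, sub_ne_zero]
  exact circleMap_ne_mem_ball hz θ

lemma normSq_lt_one {z : ℂ} (hz : z ∈ ball (0 : ℂ) 1) : Complex.normSq z < 1 := by
  rw [Complex.normSq_eq_norm_sq]
  have h : ‖z‖ < 1 := by simpa using hz
  nlinarith [norm_nonneg z]

lemma continuous_normSq_exp_sub (z : ℂ) :
    Continuous (fun θ => Complex.normSq (circleMap 0 1 θ - z)) :=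
  Complex.continuous_normSq.comp (by fun_prop)

lemma re_two_mul_div_sq {z : ℂ} (hz : z ∈ ball (0 : ℂ) 1) (v : ℂ) (θ : ℝ) :
    (2 * circleMap 0 1 θ * v / (circleMap 0 1 θ - z) ^ 2).re =
      2 / Complex.normSq (circleMap 0 1 θ - z) ^ 2 *
        (-2 * (v.re * z.re + v.im * z.im) +
        ((v.re + (v.re * (z.re ^ 2 - z.im ^ 2) + 2 * z.re * z.im * v.im)) * Real.cos θ +
          (v.im - (v.im * (z.re ^ 2 - z.im ^ 2) - 2 * z.re * z.im * v.re)) * Real.sin θ)) := by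
  have hN := (normSq_exp_sub_pos hz θ).ne'
  set ζ := circleMap 0 1 θ with hζ
  have hc : ζ.re = Real.cos θ := by
    rw [hζ, circleMap_zero, Complex.ofReal_one, one_mul, Complex.exp_ofReal_mul_I_re]
  have hs : ζ.im = Real.sin θ := by
    rw [hζ, circleMap_zero, Complex.ofReal_one, one_mul, Complex.exp_ofReal_mul_I_im]
  have hsub : ζ - z ≠ 0 := sub_ne_zero.2 (circleMap_ne_mem_ball hz θ)
  have hsub' : starRingEnd ℂ (ζ - z) ≠ 0 := (map_ne_zero _).2 hsub
  have hunit : ζ * starRingEnd ℂ ζ = 1 := by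
    rw [Complex.mul_conj, Complex.normSq_eq_norm_sq, hζ]; simp
  have key : 2 * ζ * v / (ζ - z) ^ 2 = ((2 / Complex.normSq (ζ - z) ^ 2 : ℝ) : ℂ) *
      (v * (starRingEnd ℂ ζ - 2 * starRingEnd ℂ z + ζ * starRingEnd ℂ z ^ 2)) := by
    push_cast
    rw [Complex.normSq_eq_conj_mul_self]
    field_simp
    rw [map_sub]
    linear_combination (v * starRingEnd ℂ ζ - 2 * v * starRingEnd ℂ z) * hunit
  rw [key, Complex.re_ofReal_mul]
  congr 1
  simp only [pow_two, Complex.mul_re, Complex.mul_im, Complex.sub_re, Complex.sub_im,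
    Complex.add_re, Complex.add_im, Complex.conj_re, Complex.conj_im, hc, hs,
    Complex.re_ofNat, Complex.im_ofNat]
  ring

namespace IsCircleLift

variable {u : ℝ → ℝ}

lemma trigPoly_eq_zero (hu : IsCircleLift u) {w : ℝ → ℝ} (hw : Continuous w)
    (hwp : ∀ t, 0 < w t) (hwper : Function.Periodic w (2 * Real.pi)) {A B C : ℝ}
    (h0 : ∫ t in (0 : ℝ)..2 * Real.pi, w t * (A + (B * Real.cos t + C * Real.sin t)) = 0)
    (h : ∫ t in (0 : ℝ)..2 * Real.pi,
      (w t * (A + (B * Real.cos t + C * Real.sin t))) • Complex.exp (u t * Complex.I) = 0) :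
    A = 0 ∧ B = 0 ∧ C = 0 := by
  have hc := hu.contDiff_exp.continuous
  have hre := congrArg Complex.reCLM h
  have him := congrArg Complex.imCLM h
  rw [← ContinuousLinearMap.intervalIntegral_comp_comm _
    (Continuous.intervalIntegrable (by fun_prop) _ _)] at hre him
  simp only [Complex.reCLM_apply, Complex.imCLM_apply, Complex.smul_re, Complex.smul_im,
    Complex.exp_ofReal_mul_I_re, Complex.exp_ofReal_mul_I_im, smul_eq_mul, Complex.zero_re,
    Complex.zero_im] at hre him
  exact trigPoly_eq_zero_of_orthogonal hu.continuous hu.strictMono hu.map_add_two_pi hw hwp hwper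
    h0 hre him

lemma injOn_ball (hu : IsCircleLift u) : InjOn (poissonExt (liftMap u)) (ball 0 1) := by
  intro z₁ hz₁ z₂ hz₂ h
  set N₁ : ℝ → ℝ := fun θ => Complex.normSq (circleMap 0 1 θ - z₁) with hN₁
  set N₂ : ℝ → ℝ := fun θ => Complex.normSq (circleMap 0 1 θ - z₂) with hN₂
  have p₁ : ∀ θ, 0 < N₁ θ := normSq_exp_sub_pos hz₁
  have p₂ : ∀ θ, 0 < N₂ θ := normSq_exp_sub_pos hz₂
  have c₁ : Continuous N₁ := continuous_normSq_exp_sub z₁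
  have c₂ : Continuous N₂ := continuous_normSq_exp_sub z₂
  have hc := hu.contDiff_exp.continuous
  have hker : ∀ z ∈ ball (0 : ℂ) 1, Continuous fun θ => poissonKernel 0 z (circleMap 0 1 θ) := by
    intro z hz
    have : ∀ θ, poissonKernel 0 z (circleMap 0 1 θ) =
        (1 - ‖z‖ ^ 2) / Complex.normSq (circleMap 0 1 θ - z) := by
      intro θ
      rw [poissonKernel_def, Complex.normSq_eq_norm_sq]; simp
    simp only [this]
    exact continuous_const.div (continuous_normSq_exp_sub z) fun θ => (normSq_exp_sub_pos hz θ).ne'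
  have hdiff : ∀ θ, poissonKernel 0 z₁ (circleMap 0 1 θ) - poissonKernel 0 z₂ (circleMap 0 1 θ) =
      (1 / (N₁ θ * N₂ θ)) * (2 * (Complex.normSq z₂ - Complex.normSq z₁) +
        (2 * ((1 - Complex.normSq z₂) * z₁.re - (1 - Complex.normSq z₁) * z₂.re) * Real.cos θ +
          2 * ((1 - Complex.normSq z₂) * z₁.im - (1 - Complex.normSq z₁) * z₂.im) *
            Real.sin θ)) := by
    intro θ
    have e₁ : poissonKernel 0 z₁ (circleMap 0 1 θ) = (1 - Complex.normSq z₁) / N₁ θ := by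
      simp only [poissonKernel_def, hN₁, Complex.normSq_eq_norm_sq]; simp
    have e₂ : poissonKernel 0 z₂ (circleMap 0 1 θ) = (1 - Complex.normSq z₂) / N₂ θ := by
      simp only [poissonKernel_def, hN₂, Complex.normSq_eq_norm_sq]; simp
    have := (p₁ θ).ne'
    have := (p₂ θ).ne'
    rw [e₁, e₂]
    field_simp
    simp only [hN₁, hN₂, normSq_exp_sub]
    ring
  have hint : ∀ f : ℂ → ℂ, (Continuous fun θ => f (circleMap 0 1 θ)) →
      poissonExt f z₁ = poissonExt f z₂ →
      ∫ θ in (0 : ℝ)..2 * Real.pi, (poissonKernel 0 z₁ (circleMap 0 1 θ) -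
        poissonKernel 0 z₂ (circleMap 0 1 θ)) • f (circleMap 0 1 θ) = 0 := by
    intro f hf hfz
    rw [poissonExt_of_mem_ball hz₁, poissonExt_of_mem_ball hz₂, Real.circleAverage_def,
      Real.circleAverage_def] at hfz
    have hk₁ := hker z₁ hz₁
    have hk₂ := hker z₂ hz₂
    simp only [sub_smul]
    have hk := intervalIntegral.integral_sub ((hk₁.smul hf).intervalIntegrable 0 (2 * Real.pi))
      ((hk₂.smul hf).intervalIntegrable 0 (2 * Real.pi)) (μ := volume)
    exact hk.trans (sub_eq_zero.2 (smul_right_injective ℂ (inv_ne_zero Real.two_pi_pos.ne') hfz))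
  have h1 := hint 1 continuous_const (by rw [poissonExt_one hz₁, poissonExt_one hz₂])
  have h2 := hint (liftMap u) (by simpa only [hu.liftMap_circleMap one_pos] using hc) h
  simp only [hu.liftMap_circleMap one_pos, hdiff] at h2
  simp only [hdiff, Pi.one_apply, Complex.real_smul, mul_one, intervalIntegral.integral_ofReal,
    Complex.ofReal_eq_zero] at h1
  obtain ⟨hA, hB, hC⟩ := hu.trigPoly_eq_zero
    (continuous_const.div (c₁.mul c₂) fun θ => (mul_pos (p₁ θ) (p₂ θ)).ne')
    (fun θ => one_div_pos.2 (mul_pos (p₁ θ) (p₂ θ)))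
    (fun θ => by simp only [Pi.div_apply, Pi.mul_apply, hN₁, hN₂, periodic_circleMap 0 1 θ]) h1 h2
  have hn : Complex.normSq z₂ = Complex.normSq z₁ := by linarith
  have hlt := normSq_lt_one hz₁
  rw [hn] at hB hC
  have h3 : 1 - Complex.normSq z₁ ≠ 0 := by linarith
  have hB' : (1 - Complex.normSq z₁) * (z₁.re - z₂.re) = 0 := by linarith
  have hC' : (1 - Complex.normSq z₁) * (z₁.im - z₂.im) = 0 := by linarith
  exact Complex.ext (sub_eq_zero.1 ((mul_eq_zero.1 hB').resolve_left h3))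
    (sub_eq_zero.1 ((mul_eq_zero.1 hC').resolve_left h3))

lemma fderiv_apply (hu : IsCircleLift u) {z : ℂ} (hz : z ∈ ball (0 : ℂ) 1) (v : ℂ) :
    fderiv ℝ (poissonExt (liftMap u)) z v = (2 * Real.pi)⁻¹ • ∫ θ in (0 : ℝ)..2 * Real.pi,
      (2 * circleMap 0 1 θ * v / (circleMap 0 1 θ - z) ^ 2).re • Complex.exp (u θ * Complex.I) := by
  rw [fderiv_poissonExt hu.circleIntegrable_liftMap hz, Real.circleAverage_def]
  simp only [hu.liftMap_circleMap one_pos]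

end IsCircleLift

lemma integral_re_two_mul_div_sq {z : ℂ} (hz : z ∈ ball (0 : ℂ) 1) (v : ℂ) :
    ∫ θ in (0 : ℝ)..2 * Real.pi,
      (2 * circleMap 0 1 θ * v / (circleMap 0 1 θ - z) ^ 2).re = 0 := by
  have h := fderiv_poissonExt (f := 1) (by simp [CircleIntegrable]) hz v
  have h2 : poissonExt 1 =ᶠ[𝓝 z] fun _ => 1 := by
    filter_upwards [isOpen_ball.mem_nhds hz] with w hw using poissonExt_one hw
  rw [h2.fderiv_eq, Real.circleAverage_def] at h
  simp only [fderiv_fun_const, Pi.zero_apply, Pi.one_apply, Complex.real_smul, mul_one,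
    intervalIntegral.integral_ofReal, _root_.zero_apply, zero_eq_mul,
    Complex.ofReal_eq_zero] at h
  exact h.resolve_left (inv_ne_zero Real.two_pi_pos.ne')

namespace IsCircleLift

variable {u : ℝ → ℝ}

lemma fderiv_injective (hu : IsCircleLift u) {z : ℂ} (hz : z ∈ ball (0 : ℂ) 1) {v : ℂ}
    (h : fderiv ℝ (poissonExt (liftMap u)) z v = 0) : v = 0 := by
  have h1 := integral_re_two_mul_div_sq hz v
  rw [hu.fderiv_apply hz, smul_eq_zero_iff_right (inv_ne_zero Real.two_pi_pos.ne')] at h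
  simp only [re_two_mul_div_sq hz v] at h h1
  have p : ∀ θ, 0 < Complex.normSq (circleMap 0 1 θ - z) ^ 2 := fun θ =>
    pow_pos (normSq_exp_sub_pos hz θ) 2
  obtain ⟨hA, hB, hC⟩ := hu.trigPoly_eq_zero
    (continuous_const.div ((continuous_normSq_exp_sub z).pow 2) fun θ => (p θ).ne')
    (fun θ => div_pos two_pos (p θ))
    (fun θ => by simp only [Pi.div_apply, Pi.pow_apply, periodic_circleMap 0 1 θ]) h1 h
  have hz1 := normSq_lt_one hz
  rw [Complex.normSq_apply] at hz1
  have hx : v.re = z.im * (z.im * v.re - z.re * v.im) := by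
    linear_combination hB + z.re / 2 * hA
  have hy : v.im = -(z.re * (z.im * v.re - z.re * v.im)) := by
    linear_combination hC + z.im / 2 * hA
  have hs : (z.im * v.re - z.re * v.im) * (1 - (z.re * z.re + z.im * z.im)) = 0 := by
    linear_combination z.im * hx - z.re * hy
  have hs0 : z.im * v.re - z.re * v.im = 0 :=
    (mul_eq_zero.1 hs).resolve_right (by linarith)
  rw [hs0] at hx hy
  exact Complex.ext (by simpa using hx) (by simpa using hy)

end IsCircleLift

namespace IsCircleLift

variable {u : ℝ → ℝ}

lemma contDiffAt (hu : IsCircleLift u) {z : ℂ} (hz : z ∈ ball (0 : ℂ) 1) :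
    ContDiffAt ℝ 2 (poissonExt (liftMap u)) z := (hu.harmonicOnNhd z hz).1

lemma continuousOn_fderiv (hu : IsCircleLift u) :
    ContinuousOn (fderiv ℝ (poissonExt (liftMap u))) (ball 0 1) := fun _ hz =>
  ((hu.contDiffAt hz).fderiv_right (m := 0) (by norm_num)).continuousAt.continuousWithinAt

lemma det_fderiv_ne_zero (hu : IsCircleLift u) {z : ℂ} (hz : z ∈ ball (0 : ℂ) 1) :
    (fderiv ℝ (poissonExt (liftMap u)) z).det ≠ 0 :=
  ContinuousLinearMap.det_ne_zero_of_injective fun _ h => hu.fderiv_injective hz h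

lemma fderiv_zero_apply (hu : IsCircleLift u) (v : ℂ) :
    fderiv ℝ (poissonExt (liftMap u)) 0 v = (2 * Real.pi)⁻¹ • ∫ θ in (0 : ℝ)..2 * Real.pi,
      (2 * (v.re * Real.cos θ + v.im * Real.sin θ)) • Complex.exp (u θ * Complex.I) := by
  rw [hu.fderiv_apply (mem_ball_self one_pos)]
  congr 2
  ext θ
  rw [re_two_mul_div_sq (mem_ball_self one_pos), sub_zero, Complex.normSq_eq_norm_sq]
  simp

lemma det_fderiv_zero_nonneg (hu : IsCircleLift u) (hodd : ∀ t, u (-t) = -u t) :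
    0 ≤ (fderiv ℝ (poissonExt (liftMap u)) 0).det := by
  have hpi := Real.pi_pos
  have hc := hu.contDiff_exp.continuous
  have huc := hu.continuous
  have hdc := hu.continuous_deriv
  have h0 : u 0 = 0 := by have := hodd 0; rw [neg_zero] at this; linarith
  have hπ : u Real.pi = Real.pi := by
    have h1 := hu.map_add_two_pi (-Real.pi)
    rw [hodd, show -Real.pi + 2 * Real.pi = Real.pi by ring] at h1
    linarith
  have h2π : u (2 * Real.pi) = 2 * Real.pi := by
    have := hu.map_add_two_pi 0; rwa [h0, zero_add] at this
  have hre : ∀ v, (fderiv ℝ (poissonExt (liftMap u)) 0 v).re = (2 * Real.pi)⁻¹ *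
      ∫ θ in (0 : ℝ)..2 * Real.pi, 2 * (v.re * Real.cos θ + v.im * Real.sin θ) *
        Real.cos (u θ) := by
    intro v
    rw [hu.fderiv_zero_apply, Complex.smul_re, smul_eq_mul, ← Complex.reCLM_apply,
      ← ContinuousLinearMap.intervalIntegral_comp_comm _
        (Continuous.intervalIntegrable (by fun_prop) _ _)]
    simp only [Complex.reCLM_apply, Complex.smul_re, smul_eq_mul, Complex.exp_ofReal_mul_I_re]
  have him : ∀ v, (fderiv ℝ (poissonExt (liftMap u)) 0 v).im = (2 * Real.pi)⁻¹ *
      ∫ θ in (0 : ℝ)..2 * Real.pi, 2 * (v.re * Real.cos θ + v.im * Real.sin θ) *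
        Real.sin (u θ) := by
    intro v
    rw [hu.fderiv_zero_apply, Complex.smul_im, smul_eq_mul, ← Complex.imCLM_apply,
      ← ContinuousLinearMap.intervalIntegral_comp_comm _
        (Continuous.intervalIntegrable (by fun_prop) _ _)]
    simp only [Complex.imCLM_apply, Complex.smul_im, smul_eq_mul, Complex.exp_ofReal_mul_I_im]
  have hpos : ∀ θ ∈ Icc 0 (2 * Real.pi), 0 ≤ Real.sin θ * Real.sin (u θ) := by
    intro θ hθ
    have m1 := hu.strictMono.monotone hθ.1
    have m2 := hu.strictMono.monotone hθ.2
    rcases le_total θ Real.pi with h | h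
    · have m3 := hu.strictMono.monotone h
      exact mul_nonneg (Real.sin_nonneg_of_nonneg_of_le_pi hθ.1 h)
        (Real.sin_nonneg_of_nonneg_of_le_pi (by linarith) (by linarith))
    · have m3 := hu.strictMono.monotone h
      rw [← Real.sin_sub_two_pi θ, ← Real.sin_sub_two_pi (u θ)]
      exact mul_nonneg_of_nonpos_of_nonpos
        (Real.sin_nonpos_of_nonpos_of_neg_pi_le (by linarith [hθ.2]) (by linarith))
        (Real.sin_nonpos_of_nonpos_of_neg_pi_le (by linarith) (by linarith))
  have I1 : 0 ≤ ∫ θ in (0 : ℝ)..2 * Real.pi, Real.sin θ * Real.sin (u θ) :=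
    intervalIntegral.integral_nonneg (by positivity) hpos
  have I2 : 0 ≤ ∫ θ in (0 : ℝ)..2 * Real.pi, Real.cos θ * Real.cos (u θ) := by
    have ibp := intervalIntegral.integral_mul_deriv_eq_deriv_mul (a := 0) (b := 2 * Real.pi)
      (u := fun θ => Real.cos (u θ)) (v := Real.sin) (u' := fun θ => -Real.sin (u θ) * deriv u θ)
      (v' := Real.cos)
      (fun θ _ => (hu.differentiable θ).hasDerivAt.cos) (fun θ _ => Real.hasDerivAt_sin θ)
      (Continuous.intervalIntegrable (by fun_prop) _ _)
      (Continuous.intervalIntegrable (by fun_prop) _ _)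
    simp only [Real.sin_two_pi, Real.sin_zero, mul_zero, sub_zero, zero_sub] at ibp
    rw [← intervalIntegral.integral_neg] at ibp
    simp only [mul_comm (Real.cos (u _))] at ibp
    rw [ibp]
    refine intervalIntegral.integral_nonneg (by positivity) fun θ hθ => ?_
    have h1 := hpos θ hθ
    have h2 : 0 ≤ deriv u θ := hu.strictMono.monotone.deriv_nonneg
    calc 0 ≤ (Real.sin θ * Real.sin (u θ)) * deriv u θ := mul_nonneg h1 h2
      _ = _ := by ring
  have I3 : ∫ θ in (0 : ℝ)..2 * Real.pi, Real.cos θ * Real.sin (u θ) = 0 := by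
    have h1 := intervalIntegral.integral_comp_sub_left (a := 0) (b := 2 * Real.pi)
      (fun θ => Real.cos θ * Real.sin (u θ)) (2 * Real.pi)
    have h2 : ∀ θ, Real.cos (2 * Real.pi - θ) * Real.sin (u (2 * Real.pi - θ)) =
        -(Real.cos θ * Real.sin (u θ)) := by
      intro θ
      rw [show 2 * Real.pi - θ = -θ + 2 * Real.pi by ring, hu.map_add_two_pi, hodd,
        Real.cos_add_two_pi, Real.sin_add_two_pi, Real.cos_neg, Real.sin_neg]
      ring
    simp only [h2, intervalIntegral.integral_neg, sub_self, sub_zero] at h1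
    linarith
  rw [ContinuousLinearMap.det_complex, hre, him, him]
  simp only [Complex.one_re, Complex.one_im, Complex.I_re, Complex.I_im, zero_mul, one_mul,
    zero_add, add_zero, mul_assoc, intervalIntegral.integral_const_mul, I3, mul_zero, sub_zero]
  positivity

lemma det_fderiv_pos (hu : IsCircleLift u) (hodd : ∀ t, u (-t) = -u t) {z : ℂ}
    (hz : z ∈ ball (0 : ℂ) 1) : 0 < (fderiv ℝ (poissonExt (liftMap u)) z).det := by
  by_contra! hneg
  have hcont : ContinuousOn (fun z => (fderiv ℝ (poissonExt (liftMap u)) z).det) (ball 0 1) := by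
    have h := hu.continuousOn_fderiv
    simp only [ContinuousLinearMap.det_complex]
    fun_prop
  obtain ⟨w, hw, hw0⟩ := (convex_ball (0 : ℂ) 1).isPreconnected.intermediate_value hz
    (mem_ball_self one_pos) hcont ⟨hneg, hu.det_fderiv_zero_nonneg hodd⟩
  exact hu.det_fderiv_ne_zero hw hw0

lemma hasStrictFDerivAt (hu : IsCircleLift u) {z : ℂ} (hz : z ∈ ball (0 : ℂ) 1) :
    HasStrictFDerivAt (poissonExt (liftMap u)) (fderiv ℝ (poissonExt (liftMap u)) z) z :=
  (hu.contDiffAt hz).hasStrictFDerivAt (by norm_num)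

lemma isOpen_image_ball (hu : IsCircleLift u) : IsOpen (poissonExt (liftMap u) '' ball 0 1) := by
  rw [isOpen_iff_mem_nhds]
  rintro _ ⟨z, hz, rfl⟩
  set e := (fderiv ℝ (poissonExt (liftMap u)) z).toContinuousLinearEquivOfDetNeZero
    (hu.det_fderiv_ne_zero hz)
  have h1 : HasStrictFDerivAt (poissonExt (liftMap u)) (e : ℂ →L[ℝ] ℂ) z := by
    simpa [e] using hu.hasStrictFDerivAt hz
  rw [← h1.map_nhds_eq_of_equiv]
  exact Filter.image_mem_map (isOpen_ball.mem_nhds hz)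

lemma norm_poissonExt_le_one (hu : IsCircleLift u) {z : ℂ} (hz : z ∈ ball (0 : ℂ) 1) :
    ‖poissonExt (liftMap u) z‖ ≤ 1 := by
  have h0 := norm_nonneg z
  have h1 : ‖z‖ < 1 := by simpa using hz
  have hz' : z = circleMap 0 ‖z‖ z.arg := by
    rw [circleMap_zero]; exact (Complex.norm_mul_exp_arg_mul_I z).symm
  rw [hz', hu.poissonExt_circleMap_eq h0 h1, norm_smul, Real.norm_of_nonneg (by positivity),
    inv_mul_le_iff₀ Real.two_pi_pos, mul_one]
  refine (intervalIntegral.norm_integral_le_of_norm_le Real.two_pi_pos.le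
    (.of_forall fun τ _ => ?_) ((continuous_poissonPolar h0 h1).intervalIntegrable _ _)).trans
    (integral_poissonPolar h0 h1).le
  rw [norm_smul, Complex.norm_exp_ofReal_mul_I, mul_one,
    Real.norm_of_nonneg (poissonPolar_pos h0 h1 τ).le]

lemma mapsTo_ball (hu : IsCircleLift u) :
    MapsTo (poissonExt (liftMap u)) (ball 0 1) (ball 0 1) := by
  intro z hz
  have h : poissonExt (liftMap u) '' ball 0 1 ⊆ closedBall 0 1 := by
    rintro _ ⟨w, hw, rfl⟩
    simpa using hu.norm_poissonExt_le_one hw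
  have h2 := interior_maximal h hu.isOpen_image_ball
  rw [interior_closedBall _ one_ne_zero] at h2
  exact h2 ⟨z, hz, rfl⟩

lemma exists_circleMap_eq {z : ℂ} (hz : z ∈ sphere (0 : ℂ) 1) : ∃ t : ℝ, z = circleMap 0 1 t := by
  refine ⟨z.arg, ?_⟩
  have := Complex.norm_mul_exp_arg_mul_I z
  rw [mem_sphere_zero_iff_norm.1 hz] at this
  rw [circleMap_zero]
  exact this.symm

lemma mapsTo_sphere (hu : IsCircleLift u) :
    MapsTo (poissonExt (liftMap u)) (sphere 0 1) (sphere 0 1) := by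
  intro z hz
  obtain ⟨t, rfl⟩ := exists_circleMap_eq hz
  rw [hu.poissonExt_boundary]
  simp [Complex.norm_exp_ofReal_mul_I]

lemma mapsTo_closedBall (hu : IsCircleLift u) :
    MapsTo (poissonExt (liftMap u)) (closedBall 0 1) (closedBall 0 1) := by
  rw [← ball_union_sphere]
  exact hu.mapsTo_ball.union_union hu.mapsTo_sphere

lemma injOn_sphere (hu : IsCircleLift u) : InjOn (poissonExt (liftMap u)) (sphere 0 1) := by
  intro z hz w hw h
  obtain ⟨s, rfl⟩ := exists_circleMap_eq hz
  obtain ⟨t, rfl⟩ := exists_circleMap_eq hw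
  rw [hu.poissonExt_boundary, hu.poissonExt_boundary, Complex.exp_eq_exp_iff_exists_int] at h
  obtain ⟨n, hn⟩ := h
  have h1 : u s = u t + n * (2 * Real.pi) := by
    have := congrArg Complex.im hn
    simpa using this
  rw [← hu.map_add_int_mul] at h1
  rw [hu.strictMono.injective h1]
  exact (periodic_circleMap 0 1).int_mul n t

lemma injOn_closedBall (hu : IsCircleLift u) : InjOn (poissonExt (liftMap u)) (closedBall 0 1) := by
  rw [← ball_union_sphere, injOn_union]
  · refine ⟨hu.injOn_ball, hu.injOn_sphere, fun z hz w hw h => ?_⟩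
    have h1 := mem_ball_zero_iff.1 (hu.mapsTo_ball hz)
    rw [h, mem_sphere_zero_iff_norm.1 (hu.mapsTo_sphere hw)] at h1
    exact lt_irrefl _ h1
  · exact sphere_disjoint_ball.symm

lemma surjOn_ball (hu : IsCircleLift u) :
    SurjOn (poissonExt (liftMap u)) (ball 0 1) (ball 0 1) := by
  have hcl : IsClosed (poissonExt (liftMap u) '' closedBall 0 1) :=
    ((isCompact_closedBall 0 1).image_of_continuousOn hu.continuousOn_poissonExt).isClosed
  refine (convex_ball (0 : ℂ) 1).isPreconnected.subset_of_closure_inter_subset hu.isOpen_image_ball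
    ⟨poissonExt (liftMap u) 0, hu.mapsTo_ball (mem_ball_self one_pos),
      mem_image_of_mem _ (mem_ball_self one_pos)⟩ ?_
  rintro w ⟨hw, hwb⟩
  obtain ⟨z, hz, rfl⟩ := closure_minimal (image_mono ball_subset_closedBall) hcl hw
  rw [← ball_union_sphere] at hz
  rcases hz with hz | hz
  · exact mem_image_of_mem _ hz
  · have h1 := mem_ball_zero_iff.1 hwb
    rw [mem_sphere_zero_iff_norm.1 (hu.mapsTo_sphere hz)] at h1
    exact absurd h1 (lt_irrefl _)

/-- **Radó–Kneser–Choquet theorem** on the open disc. -/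
lemma bijOn_ball (hu : IsCircleLift u) :
    BijOn (poissonExt (liftMap u)) (ball 0 1) (ball 0 1) :=
  ⟨hu.mapsTo_ball, hu.injOn_ball, hu.surjOn_ball⟩

lemma surjective (hu : IsCircleLift u) : Function.Surjective u := by
  intro y
  have h0 := hu.map_add_int_mul 0
  simp only [zero_add] at h0
  obtain ⟨m, hm⟩ := exists_int_lt ((y - u 0) / (2 * Real.pi))
  obtain ⟨n, hn⟩ := exists_int_gt ((y - u 0) / (2 * Real.pi))
  rw [lt_div_iff₀ Real.two_pi_pos] at hm
  rw [div_lt_iff₀ Real.two_pi_pos] at hn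
  exact mem_range_of_exists_le_of_exists_ge hu.continuous
    ⟨m * (2 * Real.pi), by rw [h0]; linarith⟩ ⟨n * (2 * Real.pi), by rw [h0]; linarith⟩

lemma surjOn_sphere (hu : IsCircleLift u) :
    SurjOn (poissonExt (liftMap u)) (sphere 0 1) (sphere 0 1) := by
  intro w hw
  obtain ⟨s, rfl⟩ := exists_circleMap_eq hw
  obtain ⟨t, rfl⟩ := hu.surjective s
  refine ⟨circleMap 0 1 t, by simp, ?_⟩
  rw [hu.poissonExt_boundary, circleMap_zero]
  simp

/-- **Radó–Kneser–Choquet theorem** on the closed disc. -/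
lemma bijOn_closedBall (hu : IsCircleLift u) :
    BijOn (poissonExt (liftMap u)) (closedBall 0 1) (closedBall 0 1) := by
  refine ⟨hu.mapsTo_closedBall, hu.injOn_closedBall, ?_⟩
  rw [← ball_union_sphere]
  exact hu.surjOn_ball.union_union hu.surjOn_sphere

end IsCircleLift

/-- The inverse of a continuous bijection of a compact set is continuous. -/
lemma continuousOn_of_invOn {X Y : Type*} [TopologicalSpace X] [TopologicalSpace Y] [T2Space Y]
    {h : X → Y} {f : Y → X} {s : Set X} {t : Set Y} (hs : IsCompact s) (hh : ContinuousOn h s)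
    (hb : BijOn h s t) (hinv : InvOn f h s t) : ContinuousOn f t := by
  rw [continuousOn_iff_isClosed]
  intro c hc
  refine ⟨h '' (s ∩ c), ((hs.inter_right hc).image_of_continuousOn
    (hh.mono inter_subset_left)).isClosed, ?_⟩
  ext y
  constructor
  · rintro ⟨hy, hyt⟩
    obtain ⟨x, hx, rfl⟩ := hb.surjOn hyt
    rw [mem_preimage, hinv.1 hx] at hy
    exact ⟨⟨x, ⟨hx, hy⟩, rfl⟩, hyt⟩
  · rintro ⟨⟨x, ⟨hx, hxc⟩, rfl⟩, hyt⟩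
    exact ⟨by rwa [mem_preimage, hinv.1 hx], hyt⟩

lemma ContinuousLinearMap.apply_eq_re_smul_add_im_smul (A : ℂ →L[ℝ] ℂ) (x : ℂ) :
    A x = x.re • A 1 + x.im • A Complex.I := by
  rw [← map_smul, ← map_smul, ← map_add]
  congr 1
  simp

lemma ContinuousLinearMap.area_map (A : ℂ →L[ℝ] ℂ) (x y : ℂ) :
    (A x).re * (A y).im - (A x).im * (A y).re = A.det * (x.re * y.im - x.im * y.re) := by
  rw [A.det_complex, A.apply_eq_re_smul_add_im_smul x, A.apply_eq_re_smul_add_im_smul y]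
  simp only [Complex.add_re, Complex.add_im, Complex.smul_re, Complex.smul_im, smul_eq_mul]
  ring

lemma Complex.area_le (x y : ℂ) : x.re * y.im - x.im * y.re ≤ ‖x‖ * ‖y‖ := by
  have h : x.re * y.im - x.im * y.re = (starRingEnd ℂ x * y).im := by
    simp only [Complex.mul_im, Complex.conj_re, Complex.conj_im]; ring
  rw [h]
  refine (Complex.im_le_norm _).trans ?_
  rw [norm_mul, Complex.norm_conj]

lemma ContinuousLinearMap.norm_le_det_mul_norm {A B : ℂ →L[ℝ] ℂ} (hA : 0 ≤ A.det)
    (hAB : ∀ y, A (B y) = y) : ‖A‖ ≤ A.det * ‖B‖ := by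
  refine A.opNorm_le_bound (by positivity) fun x => ?_
  by_cases hx : A x = 0
  · rw [hx, norm_zero]; positivity
  have h1 := A.area_map x (B (Complex.I * A x))
  rw [hAB] at h1
  have h2 : (A x).re * (Complex.I * A x).im - (A x).im * (Complex.I * A x).re = ‖A x‖ ^ 2 := by
    rw [← Complex.normSq_eq_norm_sq, Complex.normSq_apply]
    simp
  have h3 : ‖B (Complex.I * A x)‖ ≤ ‖B‖ * ‖A x‖ := by
    simpa using B.le_opNorm (Complex.I * A x)
  have h4 : ‖A x‖ ^ 2 ≤ A.det * (‖x‖ * (‖B‖ * ‖A x‖)) := by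
    rw [← h2, h1]
    refine mul_le_mul_of_nonneg_left ((Complex.area_le _ _).trans ?_) hA
    gcongr
  refine le_of_mul_le_mul_right ?_ (norm_pos_iff.2 hx)
  calc ‖A x‖ * ‖A x‖ = ‖A x‖ ^ 2 := (sq _).symm
    _ ≤ _ := h4
    _ = _ := by ring

lemma ContinuousLinearMap.det_le_norm_mul (A : ℂ →L[ℝ] ℂ) {e : ℂ} (he : ‖e‖ = 1) :
    A.det ≤ ‖A‖ * ‖A (Complex.I * e)‖ := by
  have h1 := A.area_map e (Complex.I * e)
  have h2 : e.re * (Complex.I * e).im - e.im * (Complex.I * e).re = 1 := by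
    have : e.re * (Complex.I * e).im - e.im * (Complex.I * e).re = Complex.normSq e := by
      rw [Complex.normSq_apply]; simp
    rw [this, Complex.normSq_eq_norm_sq, he, one_pow]
  rw [h2, mul_one] at h1
  rw [← h1]
  refine (Complex.area_le _ _).trans ?_
  gcongr
  simpa [he] using A.le_opNorm e

/-- Integration by parts: a `C¹` function on an open set has its differential as a weak
differential. -/
lemma isWeakDifferential_fderiv {U : Set ℂ} (hU : IsOpen U) {f : ℂ → ℂ}
    (hf : ∀ z ∈ U, DifferentiableAt ℝ f z) (hf' : ContinuousOn (fderiv ℝ f) U) :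
    IsWeakDifferential U f (fderiv ℝ f) := by
  intro ψ hψ hψc hψU v
  have hψd : Differentiable ℝ ψ := hψ.differentiable (by simp)
  have hψ'c : Continuous (fderiv ℝ ψ) := hψ.continuous_fderiv (by simp)
  have hout : ∀ z, z ∉ tsupport ψ → ψ z = 0 := fun z hz => image_eq_zero_of_notMem_tsupport hz
  have hout' : ∀ z, z ∉ tsupport ψ → fderiv ℝ ψ z = 0 := fun z hz =>
    image_eq_zero_of_notMem_tsupport (fun h => hz (tsupport_fderiv_subset ℝ h))
  have hcont : ∀ {E : Type} [NormedAddCommGroup E] (F : ℂ → E), ContinuousOn F U →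
      (∀ z, z ∉ tsupport ψ → F z = 0) → Continuous F ∧ HasCompactSupport F := by
    intro E _ F hF hF0
    refine ⟨continuous_iff_continuousAt.2 fun z => ?_,
      HasCompactSupport.intro hψc fun z hz => hF0 z hz⟩
    by_cases hz : z ∈ tsupport ψ
    · exact hF.continuousAt (hU.mem_nhds (hψU hz))
    · refine (continuousAt_const (y := (0 : E))).congr ?_
      filter_upwards [(isClosed_tsupport ψ).isOpen_compl.mem_nhds hz] with w hw using (hF0 w hw).symm
  have hfc : ContinuousOn f U := fun z hz => (hf z hz).continuousAt.continuousWithinAt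
  set θ : ℂ → ℂ := fun z => ψ z • f z with hθ
  have hθd : ∀ z, HasFDerivAt θ (ψ z • fderiv ℝ f z + (fderiv ℝ ψ z).smulRight (f z)) z := by
    intro z
    by_cases hz : z ∈ tsupport ψ
    · exact (hψd z).hasFDerivAt.smul (hf z (hψU hz)).hasFDerivAt
    · rw [hout z hz, hout' z hz]
      have h0 : θ =ᶠ[𝓝 z] fun _ => 0 := by
        filter_upwards [(isClosed_tsupport ψ).isOpen_compl.mem_nhds hz] with w hw
        simp [hθ, hout w hw]
      simpa using (hasFDerivAt_const (0 : ℂ) z).congr_of_eventuallyEq h0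
  have hfd : ∀ z, fderiv ℝ θ z v = ψ z • fderiv ℝ f z v + fderiv ℝ ψ z v • f z := by
    intro z; rw [(hθd z).fderiv]; simp
  obtain ⟨c1, s1⟩ := hcont (fun z => ψ z • fderiv ℝ f z v)
    (hψ.continuous.continuousOn.smul (hf'.clm_apply continuousOn_const))
    (fun z hz => by simp [hout z hz])
  obtain ⟨c2, s2⟩ := hcont (fun z => fderiv ℝ ψ z v • f z)
    ((hψ'c.clm_apply continuous_const).continuousOn.smul hfc)
    (fun z hz => by simp [hout' z hz])
  obtain ⟨c3, s3⟩ := hcont θ (hψ.continuous.continuousOn.smul hfc)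
    (fun z hz => by simp [hθ, hout z hz])
  have i1 := c1.integrable_of_hasCompactSupport (μ := volume) s1
  have i2 := c2.integrable_of_hasCompactSupport (μ := volume) s2
  have i3 := c3.integrable_of_hasCompactSupport (μ := volume) s3
  have key := integral_smul_fderiv_eq_neg_fderiv_smul_of_integrable (μ := volume) (𝕜 := ℝ)
    (f := fun _ : ℂ => (1 : ℝ)) (g := θ) (v := v) (by simp)
    (by simp only [hfd, one_smul]; exact i1.add i2)
    (by simpa using i3) (fun z _ => differentiableAt_const _)
    (fun z _ => (hθd z).differentiableAt)
  simp only [hfd, one_smul, fderiv_fun_const, Pi.zero_apply, _root_.zero_apply, zero_smul,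
    integral_zero, neg_zero] at key
  rw [integral_add i1 i2] at key
  rw [setIntegral_eq_integral_of_forall_compl_eq_zero, setIntegral_eq_integral_of_forall_compl_eq_zero]
  · rw [eq_neg_iff_add_eq_zero, add_comm]; exact key
  · intro z hz; simp [hout z (fun h => hz (hψU h))]
  · intro z hz; simp [hout' z (fun h => hz (hψU h))]

/-- Weak differentials are unique almost everywhere. -/
lemma IsWeakDifferential.ae_eq {U : Set ℂ} (hU : IsOpen U) {f : ℂ → ℂ} {g₁ g₂ : ℂ → ℂ →L[ℝ] ℂ}
    (h₁ : IsWeakDifferential U f g₁) (h₂ : IsWeakDifferential U f g₂)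
    (l₁ : LocallyIntegrableOn g₁ U) (l₂ : LocallyIntegrableOn g₂ U) :
    ∀ᵐ z, z ∈ U → g₁ z = g₂ z := by
  have hv : ∀ v : ℂ, ∀ᵐ z, z ∈ U → g₁ z v - g₂ z v = 0 := by
    intro v
    have m₁ : LocallyIntegrableOn (fun z => g₁ z v) U := fun z hz =>
      let ⟨s, hs, hi⟩ := l₁ z hz; ⟨s, hs, hi.apply_continuousLinearMap v⟩
    have m₂ : LocallyIntegrableOn (fun z => g₂ z v) U := fun z hz =>
      let ⟨s, hs, hi⟩ := l₂ z hz; ⟨s, hs, hi.apply_continuousLinearMap v⟩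
    refine hU.ae_eq_zero_of_integral_contDiff_smul_eq_zero (m₁.sub m₂) fun ψ hψ hψc hψU => ?_
    have e₁ := h₁ ψ hψ hψc hψU v
    have e₂ := h₂ ψ hψ hψc hψU v
    rw [e₁, neg_inj] at e₂
    have i : ∀ g : ℂ → ℂ, LocallyIntegrableOn g U → Integrable (fun z => ψ z • g z)
        (volume.restrict U) := by
      intro g hg
      have hK : IntegrableOn g (tsupport ψ) := hg.integrableOn_compact_subset hψU hψc
      have := hK.continuousOn_smul hψ.continuous.continuousOn hψc
      refine Integrable.integrableOn ?_
      refine (integrableOn_iff_integrable_of_support_subset ?_).1 this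
      intro z hz
      refine subset_tsupport ψ ?_
      intro h0
      simp [h0] at hz
    have e₃ : ∫ z in U, ψ z • (g₁ z v - g₂ z v) = 0 := by
      simp only [smul_sub]
      rw [integral_sub (i _ m₁) (i _ m₂), e₂, sub_self]
    rw [← e₃, setIntegral_eq_integral_of_forall_compl_eq_zero]
    intro z hz
    simp [image_eq_zero_of_notMem_tsupport fun h => hz (hψU h)]
  filter_upwards [hv 1, hv Complex.I] with z h1 hI hz
  ext x
  rw [(g₁ z).apply_eq_re_smul_add_im_smul, (g₂ z).apply_eq_re_smul_add_im_smul,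
    sub_eq_zero.1 (h1 hz), sub_eq_zero.1 (hI hz)]

/-- If the inverse of a `C¹` orientation preserving diffeomorphism of the disc is in `W^{1,2}`,
then the distortion is integrable. -/
lemma integrableOn_distortion_of_memSobolevOne {h f : ℂ → ℂ} (hb : BijOn h (ball 0 1) (ball 0 1))
    (hd : ∀ z ∈ ball (0 : ℂ) 1, DifferentiableAt ℝ h z)
    (hc : ContinuousOn (fderiv ℝ h) (ball 0 1))
    (hJ : ∀ z ∈ ball (0 : ℂ) 1, 0 < jacobianDet h z)
    (hinv : LeftInvOn f h (ball 0 1)) (hfc : ContinuousOn f (ball 0 1))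
    (hW : MemSobolevOne 2 (ball 0 1) f) : IntegrableOn (distortion h) (ball 0 1) := by
  have hfmem : ∀ w ∈ ball (0 : ℂ) 1, f w ∈ ball (0 : ℂ) 1 := by
    intro w hw
    obtain ⟨z, hz, rfl⟩ := hb.surjOn hw
    rwa [hinv hz]
  have hhf : ∀ w ∈ ball (0 : ℂ) 1, h (f w) = w := by
    intro w hw
    obtain ⟨z, hz, rfl⟩ := hb.surjOn hw
    rw [hinv hz]
  have hfd : ∀ w ∈ ball (0 : ℂ) 1,
      HasFDerivAt f (ContinuousLinearMap.inverse (fderiv ℝ h (f w))) w ∧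
      (fderiv ℝ h (f w)).IsInvertible := by
    intro w hw
    set e := (fderiv ℝ h (f w)).toContinuousLinearEquivOfDetNeZero (hJ _ (hfmem w hw)).ne'
    have he : (e : ℂ →L[ℝ] ℂ) = fderiv ℝ h (f w) :=
      ContinuousLinearMap.coe_toContinuousLinearEquivOfDetNeZero _ _
    rw [← he, ContinuousLinearMap.inverse_equiv]
    refine ⟨HasFDerivAt.of_local_left_inverse (f := h)
      (hfc.continuousAt (isOpen_ball.mem_nhds hw)) ?_ ?_, ⟨e, rfl⟩⟩
    · rw [he]; exact (hd _ (hfmem w hw)).hasFDerivAt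
    · filter_upwards [isOpen_ball.mem_nhds hw] with y hy using hhf y hy
  have hf' : ContinuousOn (fderiv ℝ f) (ball 0 1) := by
    have h1 : ContinuousOn (fun w => ContinuousLinearMap.inverse (fderiv ℝ h (f w))) (ball 0 1) := by
      intro w hw
      obtain ⟨e, he⟩ := (hfd w hw).2
      have h2 : ContinuousAt ContinuousLinearMap.inverse (fderiv ℝ h (f w)) := by
        rw [← he]; exact (contDiffAt_map_inverse (n := 0) e).continuousAt
      exact h2.comp_continuousWithinAt (f := fun w => fderiv ℝ h (f w)) (hc.comp hfc hfmem w hw)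
    exact h1.congr fun w hw => (hfd w hw).1.fderiv
  obtain ⟨-, g, hg, hgw⟩ := hW
  have hfw := isWeakDifferential_fderiv isOpen_ball (fun w hw => (hfd w hw).1.differentiableAt) hf'
  have : IsFiniteMeasure (volume.restrict (ball (0 : ℂ) 1)) :=
    ⟨by rw [Measure.restrict_apply_univ]; exact measure_ball_lt_top⟩
  have hae := hgw.ae_eq isOpen_ball hfw
    (IntegrableOn.locallyIntegrableOn (hg.integrable (by norm_num)))
    (hf'.locallyIntegrableOn isOpen_ball.measurableSet)
  have hmem : MemLp (fderiv ℝ f) 2 (volume.restrict (ball 0 1)) :=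
    hg.ae_eq ((ae_restrict_iff' measurableSet_ball).2 hae)
  have hfin : ∫⁻ w in ball (0 : ℂ) 1, ‖fderiv ℝ f w‖ₑ ^ 2 < ⊤ := by
    have := hmem.eLpNorm_lt_top
    rw [eLpNorm_lt_top_iff_lintegral_rpow_enorm_lt_top (by norm_num) (by norm_num)] at this
    simpa using this
  have hchange := lintegral_image_eq_lintegral_abs_det_fderiv_mul volume measurableSet_ball
    (fun z hz => (hd z hz).hasFDerivAt.hasFDerivWithinAt) hb.injOn (fun w => ‖fderiv ℝ f w‖ₑ ^ 2)
  rw [hb.image_eq] at hchange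
  rw [hchange] at hfin
  have hKc : ContinuousOn (distortion h) (ball 0 1) := by
    have hdet : ContinuousOn (fun z => jacobianDet h z) (ball 0 1) := by
      simp only [jacobianDet, ContinuousLinearMap.det_complex]
      fun_prop
    exact (hc.norm.pow 2).div hdet fun z hz => (hJ z hz).ne'
  refine ⟨hKc.aestronglyMeasurable measurableSet_ball, ?_⟩
  refine lt_of_le_of_lt (setLIntegral_mono' measurableSet_ball fun z hz => ?_) hfin
  have hJz := hJ z hz
  have hw := hb.mapsTo hz
  obtain ⟨h1, e, he⟩ := hfd _ hw
  rw [hinv hz] at he h1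
  have h2 : ‖fderiv ℝ h z‖ ≤ jacobianDet h z * ‖fderiv ℝ f (h z)‖ := by
    refine ContinuousLinearMap.norm_le_det_mul_norm hJz.le fun y => ?_
    rw [h1.fderiv, ← he, ContinuousLinearMap.inverse_equiv]
    simp
  rw [distortion, Real.enorm_of_nonneg (div_nonneg (sq_nonneg _) hJz.le), ← ofReal_norm,
    ← ENNReal.ofReal_pow (norm_nonneg _), ← ENNReal.ofReal_mul (abs_nonneg _)]
  refine ENNReal.ofReal_le_ofReal ?_
  rw [show |(fderiv ℝ h z).det| = jacobianDet h z from abs_of_pos hJz, div_le_iff₀ hJz]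
  calc ‖fderiv ℝ h z‖ ^ 2 ≤ (jacobianDet h z * ‖fderiv ℝ f (h z)‖) ^ 2 := by gcongr
    _ = _ := by ring

namespace IsCircleLift

variable {u : ℝ → ℝ}

lemma periodic_deriv (hu : IsCircleLift u) : Function.Periodic (deriv u) (2 * Real.pi) := by
  intro t
  rw [← deriv_comp_add_const]
  simp only [hu.map_add_two_pi, deriv_add_const]

lemma deriv_nonneg (hu : IsCircleLift u) (t : ℝ) : 0 ≤ deriv u t :=
  hu.strictMono.monotone.deriv_nonneg

lemma exists_abs_sub_le (hu : IsCircleLift u) : ∃ L, 0 ≤ L ∧ ∀ s t, |u s - u t| ≤ L * |s - t| := by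
  obtain ⟨L, hL, h⟩ := hu.periodic_deriv.exists_norm_le Real.two_pi_pos.ne' hu.continuous_deriv
  exact ⟨L, hL, fun s t => convex_univ.norm_image_sub_le_of_norm_deriv_le
    (fun x _ => hu.differentiable x) (fun x _ => h x) (mem_univ t) (mem_univ s)⟩

lemma exists_one_sub_cos_le (hu : IsCircleLift u) : ∃ C, 0 ≤ C ∧
    ∀ t τ, 1 - Real.cos (u (t + τ) - u t) ≤ C * (1 - Real.cos τ) := by
  obtain ⟨L, hL, h⟩ := hu.exists_abs_sub_le
  refine ⟨L ^ 2 / 2 * (Real.pi ^ 2 / 2), by positivity, fun t x => ?_⟩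
  obtain ⟨τ, n, hτ, rfl⟩ := exists_abs_le_pi_add_int_mul x
  rw [← add_assoc, hu.map_add_int_mul, Real.cos_add_int_mul_two_pi, add_sub_right_comm,
    Real.cos_add_int_mul_two_pi]
  have h1 : |u (t + τ) - u t| ≤ L * |τ| := by simpa using h (t + τ) t
  have h2 := Real.one_sub_sq_div_two_le_cos (x := u (t + τ) - u t)
  have h3 : (u (t + τ) - u t) ^ 2 ≤ L ^ 2 * τ ^ 2 := by
    rw [← sq_abs, ← sq_abs τ, ← mul_pow]; gcongr
  have h4 := sq_le_one_sub_cos hτ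
  have h5 : L ^ 2 * τ ^ 2 ≤ L ^ 2 * (Real.pi ^ 2 / 2 * (1 - Real.cos τ)) := by gcongr
  linarith

/-- Upper bound for the angular derivative of the harmonic extension. -/
lemma exists_norm_fderiv_angular_le (hu : IsCircleLift u) (hu' : ContDiff ℝ 2 (deriv u)) :
    ∃ M, 0 ≤ M ∧ ∀ r t, 0 ≤ r → r < 1 →
      ‖fderiv ℝ (poissonExt (liftMap u)) (circleMap 0 r t) (circleMap 0 r t * Complex.I)‖ ≤
        deriv u t + M * (1 - r) := by
  obtain ⟨M, hM0, hM⟩ := exists_norm_sub_sin_smul_deriv_le hu' hu.periodic_deriv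
  refine ⟨M, hM0, fun r t h0 h1 => ?_⟩
  have hp := continuous_poissonPolar h0 h1
  have hψ := hu.contDiff_exp.continuous
  have hdψ : ∀ s, HasDerivAt (fun s => Complex.exp (u s * Complex.I))
      (Complex.exp (u s * Complex.I) * (deriv u s * Complex.I)) s := fun s =>
    ((hu.differentiable s).hasDerivAt.ofReal_comp.mul_const _).cexp
  have huc := hu.continuous
  have hdc := hu.continuous_deriv
  obtain ⟨L, hL, hLb⟩ := hu.periodic_deriv.exists_norm_le Real.two_pi_pos.ne' hdc
  have hn : ∀ s, ‖Complex.exp (u s * Complex.I) * (deriv u s * Complex.I)‖ = deriv u s := by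
    intro s
    rw [norm_mul, Complex.norm_exp_ofReal_mul_I, one_mul, norm_mul, Complex.norm_I, mul_one,
      Complex.norm_real, Real.norm_of_nonneg (hu.deriv_nonneg s)]
  have d1 : HasDerivAt (fun s => poissonExt (liftMap u) (circleMap 0 r s))
      (fderiv ℝ (poissonExt (liftMap u)) (circleMap 0 r t) (circleMap 0 r t * Complex.I)) t :=
    ((hu.contDiffAt (circleMap_mem_ball_one h0 h1 t)).differentiableAt
      (by norm_num)).hasFDerivAt.comp_hasDerivAt t (hasDerivAt_circleMap 0 r t)
  have d2 := (intervalIntegral.hasDerivAt_integral_of_dominated_loc_of_deriv_le (𝕜 := ℝ)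
    (μ := volume) (a := 0) (b := 2 * Real.pi) (x₀ := t) (s := univ)
    (F := fun s τ => poissonPolar r τ • Complex.exp (u (s + τ) * Complex.I))
    (F' := fun s τ => poissonPolar r τ •
      (Complex.exp (u (s + τ) * Complex.I) * (deriv u (s + τ) * Complex.I)))
    (bound := fun τ => poissonPolar r τ * L) Filter.univ_mem
    (.of_forall fun s => Continuous.aestronglyMeasurable (by fun_prop))
    (Continuous.intervalIntegrable (by fun_prop) _ _)
    (Continuous.aestronglyMeasurable (by fun_prop))
    (.of_forall fun τ _ s _ => by
      rw [norm_smul, hn, Real.norm_of_nonneg (poissonPolar_pos h0 h1 τ).le]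
      exact mul_le_mul_of_nonneg_left ((le_abs_self _).trans (hLb _)) (poissonPolar_pos h0 h1 τ).le)
    (Continuous.intervalIntegrable (by fun_prop) _ _)
    (.of_forall fun τ _ s _ => ((hdψ (s + τ)).comp_add_const s τ).fun_const_smul _)).2
  have d3 := d2.const_smul (2 * Real.pi)⁻¹
  have d4 : HasDerivAt (fun s => poissonExt (liftMap u) (circleMap 0 r s)) _ t :=
    d3.congr_of_eventuallyEq (.of_forall fun s => hu.poissonExt_circleMap_eq h0 h1 s)
  rw [d1.unique d4, norm_smul, Real.norm_of_nonneg (by positivity)]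
  have h2 := norm_poissonPolar_mean_sub_le hdc (hM t) h0 h1
  have h3 := (le_abs_self _).trans h2
  have h4 : ‖∫ τ in (0 : ℝ)..2 * Real.pi, poissonPolar r τ •
      (Complex.exp (u (t + τ) * Complex.I) * (deriv u (t + τ) * Complex.I))‖ ≤
      ∫ τ in (0 : ℝ)..2 * Real.pi, poissonPolar r τ • deriv u (t + τ) := by
    refine intervalIntegral.norm_integral_le_of_norm_le Real.two_pi_pos.le
      (.of_forall fun τ _ => ?_) (Continuous.intervalIntegrable (by fun_prop) _ _)
    rw [norm_smul, hn, Real.norm_of_nonneg (poissonPolar_pos h0 h1 τ).le, smul_eq_mul]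
  have h5 := mul_le_mul_of_nonneg_left h4 (inv_nonneg.2 Real.two_pi_pos.le)
  rw [smul_eq_mul] at h3
  linarith

end IsCircleLift

/-- The radial derivative of the Poisson kernel in polar form. -/
noncomputable def poissonPolarDeriv (r τ : ℝ) : ℝ :=
  2 / ((1 - r) ^ 2 + 2 * r * (1 - Real.cos τ)) ^ 2 * ((1 + r ^ 2) * Real.cos τ - 2 * r)

lemma continuous_poissonPolarDeriv {r : ℝ} (h0 : 0 ≤ r) (h1 : r < 1) :
    Continuous (poissonPolarDeriv r) := by
  refine Continuous.mul (Continuous.div (by fun_prop) (by fun_prop) fun τ => ?_) (by fun_prop)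
  exact pow_ne_zero 2 (poissonPolar_denom_pos h0 h1 τ).ne'

lemma re_radial_kernel {r : ℝ} (h0 : 0 ≤ r) (h1 : r < 1) (t τ : ℝ) :
    (2 * circleMap 0 1 (τ + t) * circleMap 0 1 t /
      (circleMap 0 1 (τ + t) - circleMap 0 r t) ^ 2).re = poissonPolarDeriv r τ := by
  have hz : (r : ℂ) ∈ ball (0 : ℂ) 1 := by simpa [abs_of_nonneg h0] using h1
  have e1 : 2 * circleMap 0 1 (τ + t) * circleMap 0 1 t /
      (circleMap 0 1 (τ + t) - circleMap 0 r t) ^ 2 =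
      2 * circleMap 0 1 τ * 1 / (circleMap 0 1 τ - r) ^ 2 := by
    have hne : circleMap 0 1 τ - r ≠ 0 := sub_ne_zero.2 (circleMap_ne_mem_ball hz τ)
    have he : circleMap 0 1 t ≠ 0 := circleMap_ne_center one_ne_zero
    have e2 : circleMap 0 1 (τ + t) = circleMap 0 1 τ * circleMap 0 1 t := by
      simp only [circleMap_zero, Complex.ofReal_add, add_mul, Complex.exp_add]; simp
    have e3 : circleMap 0 r t = r * circleMap 0 1 t := by simp [circleMap_zero]
    rw [e2, e3, ← sub_mul, mul_pow]
    field_simp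
  have e4 := normSq_circleMap_sub r 0 τ
  rw [add_zero, show circleMap 0 r 0 = (r : ℂ) by simp [circleMap_zero]] at e4
  rw [e1, re_two_mul_div_sq hz, e4, poissonPolarDeriv]
  simp only [Complex.one_re, Complex.ofReal_re, Complex.one_im, Complex.ofReal_im]
  ring

lemma integral_poissonPolarDeriv {r : ℝ} (h0 : 0 ≤ r) (h1 : r < 1) :
    ∫ τ in (0 : ℝ)..2 * Real.pi, poissonPolarDeriv r τ = 0 := by
  have h := integral_re_two_mul_div_sq (circleMap_mem_ball_one h0 h1 0) (circleMap 0 1 0)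
  rw [← h]
  congr 1; ext τ
  rw [← re_radial_kernel h0 h1 0 τ, add_zero]

/-- Pointwise lower bound behind the boundary estimate of the radial derivative. -/
lemma le_neg_poissonPolarDeriv_mul {r : ℝ} (h0 : 1 / 2 ≤ r) (h1 : r < 1) {τ s C : ℝ} (hs : 0 ≤ s)
    (hC : 0 ≤ C) (hsC : s ≤ C * (1 - Real.cos τ)) :
    (1 - Real.cos τ) * s / 8 - 2 * C * (1 - r) * poissonPolar r τ ≤ -poissonPolarDeriv r τ * s := by
  have hN := poissonPolar_denom_pos (by linarith) h1 τ
  have hq := Real.cos_le_one τ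
  have hq' := Real.neg_one_le_cos τ
  rw [poissonPolar, poissonPolarDeriv]
  set q := 1 - Real.cos τ with hq0
  have hcos : Real.cos τ = 1 - q := by rw [hq0]; ring
  rw [hcos]
  have hqn : 0 ≤ q := by linarith
  set N := (1 - r) ^ 2 + 2 * r * q with hNdef
  have hN4 : N ≤ 4 := by nlinarith
  have hqN : q ≤ N := by nlinarith [sq_nonneg (1 - r)]
  have hN2 : N ^ 2 ≤ 16 := by nlinarith
  have e1 : -(2 / N ^ 2 * ((1 + r ^ 2) * (1 - q) - 2 * r)) * s =
      2 * (1 + r ^ 2) * (q * s) / N ^ 2 - 2 * (1 - r) ^ 2 * s / N ^ 2 := by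
    field_simp; ring
  have e2 : q * s / 8 ≤ 2 * (1 + r ^ 2) * (q * s) / N ^ 2 := by
    rw [div_le_div_iff₀ (by norm_num) (by positivity)]
    have hqs : 0 ≤ q * s := by positivity
    nlinarith [mul_le_mul_of_nonneg_left hN2 hqs, mul_nonneg (sq_nonneg r) hqs]
  have e3 : 2 * (1 - r) ^ 2 * s / N ^ 2 ≤ 2 * C * (1 - r) * ((1 - r ^ 2) / N) := by
    have h4 : s ≤ C * N := hsC.trans (by gcongr)
    calc 2 * (1 - r) ^ 2 * s / N ^ 2 ≤ 2 * (1 - r) ^ 2 * (C * N) / N ^ 2 := by gcongr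
      _ = 2 * C * (1 - r) * ((1 - r) / N) := by field_simp
      _ ≤ 2 * C * (1 - r) * ((1 - r ^ 2) / N) := by
        have : 1 - r ≤ 1 - r ^ 2 := by nlinarith
        have : 0 ≤ 1 - r := by linarith
        gcongr
  rw [e1]
  linarith

namespace IsCircleLift

variable {u : ℝ → ℝ}

/-- Lower bound for the radial derivative of the harmonic extension. -/
lemma exists_le_norm_fderiv_radial (hu : IsCircleLift u) : ∃ C, 0 ≤ C ∧
    ∀ r t, 1 / 2 ≤ r → r < 1 →
      (2 * Real.pi)⁻¹ * ((∫ τ in (0 : ℝ)..2 * Real.pi,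
        (1 - Real.cos τ) * (1 - Real.cos (u (t + τ) - u t))) / 8) - C * (1 - r) ≤
      ‖fderiv ℝ (poissonExt (liftMap u)) (circleMap 0 r t) (circleMap 0 1 t)‖ := by
  obtain ⟨C, hC0, hC⟩ := hu.exists_one_sub_cos_le
  refine ⟨2 * C, by positivity, fun r t hr h1 => ?_⟩
  have h0 : 0 ≤ r := by linarith
  have hp := continuous_poissonPolar h0 h1
  have hk := continuous_poissonPolarDeriv h0 h1
  have hψ := hu.contDiff_exp.continuous
  have huc := hu.continuous
  have e1 : fderiv ℝ (poissonExt (liftMap u)) (circleMap 0 r t) (circleMap 0 1 t) =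
      (2 * Real.pi)⁻¹ • ∫ τ in (0 : ℝ)..2 * Real.pi,
        poissonPolarDeriv r τ • Complex.exp (u (t + τ) * Complex.I) := by
    rw [fderiv_poissonExt hu.circleIntegrable_liftMap (circleMap_mem_ball_one h0 h1 t),
      Real.circleAverage_eq_integral_add t]
    simp only [re_radial_kernel h0 h1, hu.liftMap_circleMap one_pos, add_comm t]
  have e2 : (Complex.exp ((-u t : ℝ) * Complex.I) *
      fderiv ℝ (poissonExt (liftMap u)) (circleMap 0 r t) (circleMap 0 1 t)).re =
      (2 * Real.pi)⁻¹ * ∫ τ in (0 : ℝ)..2 * Real.pi,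
        poissonPolarDeriv r τ * Real.cos (u (t + τ) - u t) := by
    rw [e1, mul_smul_comm, Complex.smul_re, smul_eq_mul, ← intervalIntegral.integral_const_mul,
      ← Complex.reCLM_apply, ← ContinuousLinearMap.intervalIntegral_comp_comm _
        (Continuous.intervalIntegrable (by fun_prop) _ _)]
    congr 2; ext τ
    rw [mul_smul_comm, ← Complex.exp_add, ← add_mul, ← Complex.ofReal_add, Complex.reCLM_apply,
      Complex.smul_re, smul_eq_mul, Complex.exp_ofReal_mul_I_re]
    congr 2; ring
  have e3 : ∫ τ in (0 : ℝ)..2 * Real.pi, poissonPolarDeriv r τ * Real.cos (u (t + τ) - u t) =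
      ∫ τ in (0 : ℝ)..2 * Real.pi,
        -poissonPolarDeriv r τ * (1 - Real.cos (u (t + τ) - u t)) := by
    have : ∀ τ, -poissonPolarDeriv r τ * (1 - Real.cos (u (t + τ) - u t)) =
      poissonPolarDeriv r τ * Real.cos (u (t + τ) - u t) - poissonPolarDeriv r τ := by intro τ; ring
    simp only [this]
    rw [intervalIntegral.integral_sub, integral_poissonPolarDeriv h0 h1, sub_zero]
    all_goals exact Continuous.intervalIntegrable (by fun_prop) _ _
  have e4 : (∫ τ in (0 : ℝ)..2 * Real.pi,
      ((1 - Real.cos τ) * (1 - Real.cos (u (t + τ) - u t)) / 8 -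
        2 * C * (1 - r) * poissonPolar r τ)) ≤
      ∫ τ in (0 : ℝ)..2 * Real.pi,
        -poissonPolarDeriv r τ * (1 - Real.cos (u (t + τ) - u t)) := by
    refine intervalIntegral.integral_mono_on Real.two_pi_pos.le
      (Continuous.intervalIntegrable (by fun_prop) _ _)
      (Continuous.intervalIntegrable (by fun_prop) _ _) fun τ _ => ?_
    exact le_neg_poissonPolarDeriv_mul hr h1 (by linarith [Real.cos_le_one (u (t + τ) - u t)])
      hC0 (hC t τ)
  rw [intervalIntegral.integral_sub (Continuous.intervalIntegrable (by fun_prop) _ _)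
    (Continuous.intervalIntegrable (by fun_prop) _ _), intervalIntegral.integral_const_mul,
    integral_poissonPolar h0 h1, intervalIntegral.integral_div] at e4
  have e5 : (Complex.exp ((-u t : ℝ) * Complex.I) *
      fderiv ℝ (poissonExt (liftMap u)) (circleMap 0 r t) (circleMap 0 1 t)).re ≤
      ‖fderiv ℝ (poissonExt (liftMap u)) (circleMap 0 r t) (circleMap 0 1 t)‖ := by
    refine (Complex.re_le_norm _).trans ?_
    rw [norm_mul, Complex.norm_exp_ofReal_mul_I, one_mul]
  rw [e2, e3] at e5
  refine le_trans ?_ e5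
  rw [← sub_nonneg]
  have e6 := mul_le_mul_of_nonneg_left e4 (inv_nonneg.2 Real.two_pi_pos.le)
  rw [mul_sub, show (2 * Real.pi)⁻¹ * (2 * C * (1 - r) * (2 * Real.pi)) = 2 * C * (1 - r) by
    field_simp] at e6
  linarith

end IsCircleLift

namespace IsCircleLift

variable {u : ℝ → ℝ}

lemma chord_energy_pos (hu : IsCircleLift u) : 0 < ∫ τ in (0 : ℝ)..2 * Real.pi,
    (1 - Real.cos τ) * (1 - Real.cos (u (0 + τ) - u 0)) := by
  have huc := hu.continuous
  refine intervalIntegral.integral_pos Real.two_pi_pos (by fun_prop) (fun τ _ => ?_)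
    ⟨Real.pi, ⟨Real.pi_pos.le, by linarith [Real.pi_pos]⟩, ?_⟩
  · exact mul_nonneg (by linarith [Real.cos_le_one τ])
      (by linarith [Real.cos_le_one (u (0 + τ) - u 0)])
  · rw [zero_add, Real.cos_pi]
    have h1 : u 0 < u Real.pi := hu.strictMono Real.pi_pos
    have h2 : u Real.pi < u 0 + 2 * Real.pi := by
      rw [← hu.map_add_two_pi]; exact hu.strictMono (by linarith [Real.pi_pos])
    have h3 : Real.cos (u Real.pi - u 0) ≠ 1 := by
      intro h
      rw [Real.cos_eq_one_iff_of_lt_of_lt (by linarith) (by linarith)] at h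
      linarith
    have h4 := lt_of_le_of_ne (Real.cos_le_one _) h3
    exact mul_pos (by norm_num) (by linarith)

/-- Near a boundary point, the distortion is bounded below by `c / (u' + M (1 - r))`. -/
lemma exists_le_distortion (hu : IsCircleLift u) (hodd : ∀ t, u (-t) = -u t)
    (hu' : ContDiff ℝ 2 (deriv u)) : ∃ c M t₀ δ₀ : ℝ, 0 < c ∧ 0 < M ∧ 0 < t₀ ∧ t₀ < 1 ∧ 0 < δ₀ ∧
      δ₀ ≤ 1 / 2 ∧ ∀ t ∈ Ioo 0 t₀, ∀ r ∈ Ioo (1 - δ₀) 1, c / (deriv u t + M * (1 - r)) ≤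
        distortion (poissonExt (liftMap u)) (circleMap 0 r t) := by
  obtain ⟨C, hC0, hC⟩ := hu.exists_le_norm_fderiv_radial
  obtain ⟨M, hM0, hM⟩ := hu.exists_norm_fderiv_angular_le hu'
  have huc := hu.continuous
  set m : ℝ → ℝ := fun t => (2 * Real.pi)⁻¹ * ((∫ τ in (0 : ℝ)..2 * Real.pi,
    (1 - Real.cos τ) * (1 - Real.cos (u (t + τ) - u t))) / 8) with hm
  have hmc : Continuous m := by
    refine continuous_const.mul (Continuous.div_const ?_ _)
    exact intervalIntegral.continuous_parametric_intervalIntegral_of_continuous' (by fun_prop) _ _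
  have hm0 : 0 < m 0 := by have := hu.chord_energy_pos; positivity
  obtain ⟨η, hη, hηm⟩ := Metric.eventually_nhds_iff.1
    (hmc.continuousAt.eventually (lt_mem_nhds (half_lt_self hm0)))
  set c := m 0 / 4
  have hc : 0 < c := by positivity
  refine ⟨c / 2, M + 1, min η (1 / 2), min (1 / 2) (c / (C + 1)), by positivity, by positivity,
    by positivity, (min_le_right _ _).trans_lt (by norm_num), by positivity, min_le_left _ _, ?_⟩
  intro t ht r hr
  have hr2 : 1 / 2 ≤ r := by linarith [hr.1, min_le_left (1 / 2) (c / (C + 1))]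
  have h0 : 0 ≤ r := by linarith
  have hδ : (1 - r) * (C + 1) ≤ c := by
    rw [← le_div_iff₀ (by positivity)]
    linarith [hr.1, min_le_right (1 / 2) (c / (C + 1))]
  have hmt : m 0 / 2 < m t := by
    refine hηm ?_
    rw [Real.dist_eq, sub_zero, abs_of_pos ht.1]
    exact ht.2.trans_le (min_le_left _ _)
  set A := fderiv ℝ (poissonExt (liftMap u)) (circleMap 0 r t) with hA
  have he : ‖circleMap 0 1 t‖ = 1 := by simp
  have hAe : c ≤ ‖A (circleMap 0 1 t)‖ := by
    have h1 : m t - C * (1 - r) ≤ ‖A (circleMap 0 1 t)‖ := hC r t hr2 hr.2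
    have h2 : m 0 / 2 - C * (1 - r) ≤ ‖A (circleMap 0 1 t)‖ := by linarith
    have h3 : m 0 / 2 = 2 * c := by simp only [c]; ring
    nlinarith [hr.2]
  have hAc : c ≤ ‖A‖ := hAe.trans (by simpa [he] using A.le_opNorm (circleMap 0 1 t))
  have hAI : r * ‖A (Complex.I * circleMap 0 1 t)‖ ≤ deriv u t + M * (1 - r) := by
    have h1 := hM r t h0 hr.2
    rwa [show circleMap 0 r t * Complex.I = r • (Complex.I * circleMap 0 1 t) by
      simp [circleMap_zero]; ring, map_smul, norm_smul, Real.norm_of_nonneg h0] at h1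
  have hdet := A.det_le_norm_mul he
  have hdetp : 0 < A.det := hu.det_fderiv_pos hodd (circleMap_mem_ball_one h0 hr.2 t)
  have hg := hu.deriv_nonneg t
  have hr1 : 0 < 1 - r := by linarith [hr.2]
  have hden : 0 < deriv u t + (M + 1) * (1 - r) := by positivity
  have hAI2 : ‖A (Complex.I * circleMap 0 1 t)‖ ≤ 2 * (deriv u t + (M + 1) * (1 - r)) := by
    have := norm_nonneg (A (Complex.I * circleMap 0 1 t))
    nlinarith
  rw [distortion, jacobianDet, div_le_div_iff₀ hden hdetp]
  have hn := norm_nonneg A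
  have hdet2 : A.det ≤ ‖A‖ * (2 * (deriv u t + (M + 1) * (1 - r))) := hdet.trans (by gcongr)
  calc c / 2 * A.det ≤ c / 2 * (‖A‖ * (2 * (deriv u t + (M + 1) * (1 - r)))) := by gcongr
    _ = c * (‖A‖ * (deriv u t + (M + 1) * (1 - r))) := by ring
    _ ≤ ‖A‖ * (‖A‖ * (deriv u t + (M + 1) * (1 - r))) := by gcongr
    _ = _ := by ring

end IsCircleLift

lemma integral_const_div_add_mul {g M c δ : ℝ} (hg : 0 < g) (hM : 0 < M) (hδ : 0 < δ) :
    ∫ r in (1 - δ)..1, c / (g + M * (1 - r)) = c / M * (Real.log (g + M * δ) - Real.log g) := by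
  have hpos : ∀ r ∈ uIcc (1 - δ) 1, 0 < g + M * (1 - r) := by
    intro r hr
    rw [uIcc_of_le (by linarith)] at hr
    have : 0 ≤ 1 - r := by linarith [hr.2]
    positivity
  have hd : ∀ r ∈ uIcc (1 - δ) 1,
      HasDerivAt (fun r => -(c / M) * Real.log (g + M * (1 - r))) (c / (g + M * (1 - r))) r := by
    intro r hr
    have h1 : HasDerivAt (fun r => g + M * (1 - r)) (M * -1) r :=
      (((hasDerivAt_id r).const_sub 1).const_mul M).const_add g
    have h2 := (h1.log (hpos r hr).ne').const_mul (-(c / M))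
    have h3 := (hpos r hr).ne'
    have e : -(c / M) * (M * -1 / (g + M * (1 - r))) = c / (g + M * (1 - r)) := by
      field_simp
    rwa [e] at h2
  rw [intervalIntegral.integral_eq_sub_of_hasDerivAt hd]
  · simp; ring
  · refine ContinuousOn.intervalIntegrable ?_
    exact continuousOn_const.div (by fun_prop) fun r hr => (hpos r hr).ne'

lemma not_lintegral_inv_sub_lt_top {t₀ A B : ℝ} (ht : 0 < t₀) (hA : 0 < A) :
    ¬ ∫⁻ t in Ioo 0 t₀, ENNReal.ofReal (A * (t⁻¹ - B)) < ⊤ := by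
  intro h
  have hi : IntegrableOn (fun t : ℝ => t⁻¹) (Ioo 0 t₀) := by
    refine ⟨by fun_prop, ?_⟩
    have hle : ∀ t ∈ Ioo 0 t₀, ‖t⁻¹‖ₑ ≤ ENNReal.ofReal A⁻¹ * ENNReal.ofReal (A * (t⁻¹ - B)) +
        ENNReal.ofReal B := by
      intro t ht
      rw [Real.enorm_of_nonneg (inv_nonneg.2 ht.1.le), ← ENNReal.ofReal_mul (by positivity),
        ← mul_assoc, inv_mul_cancel₀ hA.ne', one_mul]
      refine le_trans (ENNReal.ofReal_le_ofReal ?_) ENNReal.ofReal_add_le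
      linarith
    refine lt_of_le_of_lt (setLIntegral_mono' measurableSet_Ioo hle) ?_
    rw [lintegral_add_right _ measurable_const, lintegral_const_mul _ (by fun_prop),
      setLIntegral_const]
    exact ENNReal.add_lt_top.2 ⟨ENNReal.mul_lt_top ENNReal.ofReal_lt_top h,
      ENNReal.mul_lt_top ENNReal.ofReal_lt_top measure_Ioo_lt_top⟩
  have h2 : IntervalIntegrable (fun t : ℝ => t⁻¹) volume 0 t₀ := by
    rw [intervalIntegrable_iff_integrableOn_Ioo_of_le ht.le]; exact hi
  rw [intervalIntegrable_inv_iff] at h2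
  rcases h2 with h2 | h2
  · exact ht.ne h2
  · exact h2 left_mem_uIcc

lemma not_integrableOn_of_polar_lower_bound {K : ℂ → ℝ} {g : ℝ → ℝ} (hg : Continuous g)
    {c M t₀ δ b : ℝ} (hc : 0 < c) (hM : 0 < M) (ht₀ : 0 < t₀) (ht₁ : t₀ < 1) (hδ : 0 < δ)
    (hδ1 : δ ≤ 1 / 2)
    (hg0 : ∀ t ∈ Ioo 0 t₀, 0 < g t) (hgb : ∀ t ∈ Ioo 0 t₀, Real.log (g t) ≤ b - t⁻¹)
    (hK : ∀ t ∈ Ioo 0 t₀, ∀ r ∈ Ioo (1 - δ) 1,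
      c / (g t + M * (1 - r)) ≤ K (circleMap 0 r t)) :
    ¬ IntegrableOn K (ball 0 1) := by
  intro hint
  have hfin : ∫⁻ z in ball (0 : ℂ) 1, ‖K z‖ₑ < ⊤ := hint.2
  rw [← lintegral_indicator measurableSet_ball, ← Complex.lintegral_comp_polarCoord_symm] at hfin
  set F : ℝ × ℝ → ℝ≥0∞ := fun p => ENNReal.ofReal (1 / 2 * (c / (g p.2 + M * (1 - p.1))))
  have hFm : Measurable F := by
    have := hg.measurable
    fun_prop
  set S : Set (ℝ × ℝ) := Ioo (1 - δ) 1 ×ˢ Ioo 0 t₀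
  have hSm : MeasurableSet S := measurableSet_Ioo.prod measurableSet_Ioo
  have hsub : S ⊆ Complex.polarCoord.target := by
    rintro ⟨r, t⟩ ⟨hr, ht⟩
    simp only [mem_Ioo] at hr ht
    rw [Complex.polarCoord_target]
    exact ⟨by simp only [mem_Ioi]; linarith, by constructor <;> linarith [Real.pi_gt_three]⟩
  have h1 : ∫⁻ p in S, F p < ⊤ := by
    refine lt_of_le_of_lt ?_ hfin
    refine le_trans (setLIntegral_mono' hSm ?_) (lintegral_mono_set hsub)
    rintro ⟨r, t⟩ ⟨hr, ht⟩
    simp only at hr ht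
    have hr' := hr; have ht' := ht
    rw [mem_Ioo] at hr' ht'
    have e : Complex.polarCoord.symm (r, t) = circleMap 0 r t := by
      rw [Complex.polarCoord_symm_apply, circleMap_zero, Complex.exp_mul_I]
      push_cast; ring
    have hk := hK t ht r hr
    have hgp := hg0 t ht
    have hpos : 0 < c / (g t + M * (1 - r)) :=
      div_pos hc (by have : 0 < 1 - r := by linarith
                     positivity)
    rw [e, indicator_of_mem (circleMap_mem_ball_one (by linarith) hr'.2 t), smul_eq_mul,
      Real.enorm_of_nonneg (hpos.le.trans hk), ← ENNReal.ofReal_mul (by linarith)]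
    refine ENNReal.ofReal_le_ofReal ?_
    have : (1 : ℝ) / 2 ≤ r := by linarith
    exact mul_le_mul this hk hpos.le (by linarith)
  rw [show (volume : Measure (ℝ × ℝ)).restrict S =
    (volume.restrict (Ioo (1 - δ) 1)).prod (volume.restrict (Ioo 0 t₀)) from
    (Measure.prod_restrict _ _).symm, lintegral_prod_symm' _ hFm] at h1
  refine not_lintegral_inv_sub_lt_top (A := 1 / 2 * (c / M)) (B := b - Real.log (M * δ)) ht₀
    (by positivity) (lt_of_le_of_lt (setLIntegral_mono' measurableSet_Ioo fun t ht => ?_) h1)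
  have hgp := hg0 t ht
  have hcont : ContinuousOn (fun r => 1 / 2 * (c / (g t + M * (1 - r)))) (Icc (1 - δ) 1) := by
    refine continuousOn_const.mul (continuousOn_const.div (by fun_prop) fun r hr => ?_)
    have : 0 ≤ 1 - r := by linarith [hr.2]
    positivity
  have hi := (hcont.integrableOn_Icc (μ := volume)).mono_set Ioo_subset_Icc_self
  rw [← ofReal_integral_eq_lintegral_ofReal hi
    ((ae_restrict_iff' measurableSet_Ioo).2 (.of_forall fun r hr => by
      have : 0 < 1 - r := by linarith [hr.2]
      simp only [Pi.zero_apply]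
      positivity)), ← integral_Ioc_eq_integral_Ioo,
    ← intervalIntegral.integral_of_le (by linarith), intervalIntegral.integral_const_mul,
    integral_const_div_add_mul hgp hM hδ]
  refine ENNReal.ofReal_le_ofReal ?_
  have h2 : Real.log (M * δ) ≤ Real.log (g t + M * δ) :=
    Real.log_le_log (by positivity) (by linarith)
  have h3 := hgb t ht
  rw [← mul_assoc]
  exact mul_le_mul_of_nonneg_left (by linarith) (by positivity)

/-- The circle map with lift `u`. -/
noncomputable def circleFun (u : ℝ → ℝ) (ξ : Circle) : Circle :=
  Circle.exp (u (Complex.arg ξ))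

lemma coe_circleFun (u : ℝ → ℝ) (ξ : Circle) : (circleFun u ξ : ℂ) = liftMap u ξ := by
  rw [circleFun, Circle.coe_exp, liftMap]

namespace IsCircleLift

variable {u : ℝ → ℝ}

lemma circleFun_exp (hu : IsCircleLift u) (t : ℝ) : circleFun u (Circle.exp t) = Circle.exp (u t) := by
  ext
  rw [coe_circleFun, Circle.coe_exp, Circle.coe_exp, ← hu.liftMap_circleMap one_pos, circleMap_zero,
    Complex.ofReal_one, one_mul]

lemma poissonExt_coe_circle (u : ℝ → ℝ) (ξ : Circle) :
    poissonExt (liftMap u) ξ = circleFun u ξ := by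
  rw [poissonExt_of_one_le_norm (by simp [Circle.norm_coe]), coe_circleFun]

lemma continuous_circleFun (hu : IsCircleLift u) : Continuous (circleFun u) := by
  have h : Continuous fun ξ : Circle => (circleFun u ξ : ℂ) := by
    simp only [← poissonExt_coe_circle]
    exact hu.continuousOn_poissonExt.comp_continuous continuous_subtype_val
      fun ξ => by simp [Circle.norm_coe]
  exact continuous_induced_rng.2 h

lemma bijective_circleFun (hu : IsCircleLift u) : Function.Bijective (circleFun u) := by
  constructor
  · intro ξ η h
    have h1 := congrArg (fun x : Circle => (x : ℂ)) h
    simp only [← poissonExt_coe_circle] at h1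
    exact Circle.ext (hu.injOn_sphere (by simp [Circle.norm_coe]) (by simp [Circle.norm_coe]) h1)
  · intro ξ
    obtain ⟨s, rfl⟩ := Circle.leftInverse_exp_arg.surjective ξ
    obtain ⟨t, rfl⟩ := hu.surjective s
    exact ⟨Circle.exp t, hu.circleFun_exp t⟩

/-- The circle homeomorphism with lift `u`. -/
noncomputable def circleHomeo (hu : IsCircleLift u) : Circle ≃ₜ Circle :=
  Continuous.homeoOfEquivCompactToT2 (f := Equiv.ofBijective _ hu.bijective_circleFun)
    hu.continuous_circleFun

lemma circleHomeo_exp (hu : IsCircleLift u) (t : ℝ) :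
    hu.circleHomeo (Circle.exp t) = Circle.exp (u t) := hu.circleFun_exp t

lemma circleHomeo_symm_exp (hu : IsCircleLift u) {v : ℝ → ℝ} (hv : Function.RightInverse v u)
    (s : ℝ) : hu.circleHomeo.symm (Circle.exp s) = Circle.exp (v s) := by
  rw [Homeomorph.symm_apply_eq, hu.circleHomeo_exp, hv s]

lemma isHarmonicExtension (hu : IsCircleLift u) :
    IsHarmonicExtension hu.circleHomeo (poissonExt (liftMap u)) where
  continuousOn := hu.continuousOn_poissonExt
  harmonic := hu.harmonicOnNhd
  boundary := poissonExt_coe_circle u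

end IsCircleLift

/-- A smooth even `2π`-periodic function which is flat at `0` and positive elsewhere. -/
noncomputable def flatBump (t : ℝ) : ℝ :=
  expNegInvGlue (Real.sin (t / 2)) + expNegInvGlue (-Real.sin (t / 2))

lemma contDiff_flatBump {n : ℕ∞} : ContDiff ℝ n flatBump := by
  have h := expNegInvGlue.contDiff (n := n)
  have h1 : ContDiff ℝ n fun t : ℝ => Real.sin (t / 2) :=
    Real.contDiff_sin.comp (contDiff_id.div_const 2)
  exact (h.comp h1).add (h.comp h1.neg)

lemma flatBump_add_two_pi (t : ℝ) : flatBump (t + 2 * Real.pi) = flatBump t := by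
  rw [flatBump, flatBump, show (t + 2 * Real.pi) / 2 = t / 2 + Real.pi by ring,
    Real.sin_add_pi, neg_neg, add_comm]

lemma flatBump_neg (t : ℝ) : flatBump (-t) = flatBump t := by
  rw [flatBump, flatBump, neg_div, Real.sin_neg, neg_neg, add_comm]

lemma flatBump_nonneg (t : ℝ) : 0 ≤ flatBump t :=
  add_nonneg (expNegInvGlue.nonneg _) (expNegInvGlue.nonneg _)

lemma flatBump_pos {t : ℝ} (h : Real.sin (t / 2) ≠ 0) : 0 < flatBump t := by
  rcases h.lt_or_gt with h | h
  · exact add_pos_of_nonneg_of_pos (expNegInvGlue.nonneg _)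
      (expNegInvGlue.pos_of_pos (by linarith))
  · exact add_pos_of_pos_of_nonneg (expNegInvGlue.pos_of_pos h) (expNegInvGlue.nonneg _)

lemma sin_half_pos {t : ℝ} (ht : t ∈ Ioo 0 (2 * Real.pi)) : 0 < Real.sin (t / 2) :=
  Real.sin_pos_of_pos_of_lt_pi (by linarith [ht.1]) (by linarith [ht.2])

lemma flatBump_eq {t : ℝ} (ht : t ∈ Ioo 0 (2 * Real.pi)) :
    flatBump t = Real.exp (-(Real.sin (t / 2))⁻¹) := by
  have h := sin_half_pos ht
  rw [flatBump, expNegInvGlue, expNegInvGlue, if_neg (not_le.2 h), if_pos (by linarith), add_zero]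

lemma expNegInvGlue_le (n : ℕ) {x : ℝ} (hx : 0 < x) : expNegInvGlue x ≤ n.factorial * x ^ n := by
  rw [expNegInvGlue, if_neg (not_le.2 hx), Real.exp_neg]
  have h := Real.pow_div_factorial_le_exp x⁻¹ (by positivity) n
  rw [inv_pow] at h
  have h2 := inv_anti₀ (by positivity) h
  rwa [inv_div, div_inv_eq_mul] at h2

lemma flatBump_le (n : ℕ) (t : ℝ) : flatBump t ≤ n.factorial * |t| ^ n := by
  have hs : |Real.sin (t / 2)| ≤ |t| := by
    refine Real.abs_sin_le_abs.trans ?_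
    rw [abs_div, abs_two]
    linarith [abs_nonneg t]
  have key : flatBump t ≤ n.factorial * |Real.sin (t / 2)| ^ n := by
    rcases lt_trichotomy (Real.sin (t / 2)) 0 with h | h | h
    · rw [flatBump, expNegInvGlue.zero_of_nonpos h.le, zero_add, abs_of_neg h]
      exact expNegInvGlue_le n (by linarith)
    · rw [flatBump, h, neg_zero, expNegInvGlue.zero, add_zero]
      positivity
    · rw [flatBump, expNegInvGlue.zero_of_nonpos (by linarith : -Real.sin (t / 2) ≤ 0), add_zero,
        abs_of_pos h]
      exact expNegInvGlue_le n h
  exact key.trans (by gcongr)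

lemma integral_flatBump_pos {a b : ℝ} (hab : a < b) : 0 < ∫ t in a..b, flatBump t := by
  refine intervalIntegral.integral_pos hab (contDiff_flatBump (n := 0)).continuous.continuousOn
    (fun t _ => flatBump_nonneg t) ?_
  by_cases h : Real.sin (a / 2) = 0
  · set d := min (b - a) 1
    have hd0 : 0 < d := lt_min (by linarith) one_pos
    have hd1 : d ≤ 1 := min_le_right _ _
    have hdb : d ≤ b - a := min_le_left _ _
    refine ⟨a + d, ⟨by linarith, by linarith⟩, flatBump_pos ?_⟩
    rw [add_div, Real.sin_add, h, zero_mul, zero_add]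
    refine mul_ne_zero ?_ (sin_half_pos ⟨hd0, by linarith [Real.pi_gt_three]⟩).ne'
    intro hc
    have := Real.sin_sq_add_cos_sq (a / 2)
    rw [h, hc] at this
    norm_num at this
  · exact ⟨a, left_mem_Icc.2 hab.le, flatBump_pos h⟩

/-- The normalising constant of the flat density. -/
noncomputable def flatConst : ℝ := 2 * Real.pi / ∫ t in (0 : ℝ)..2 * Real.pi, flatBump t

lemma flatConst_pos : 0 < flatConst :=
  div_pos Real.two_pi_pos (integral_flatBump_pos Real.two_pi_pos)

/-- The lift of the boundary homeomorphism, with derivative a multiple of `flatBump`. -/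
noncomputable def flatLift (t : ℝ) : ℝ := ∫ s in (0 : ℝ)..t, flatConst * flatBump s

lemma continuous_flatBump : Continuous flatBump := (contDiff_flatBump (n := 0)).continuous

lemma hasDerivAt_flatLift (t : ℝ) : HasDerivAt flatLift (flatConst * flatBump t) t := by
  have hc : Continuous fun s => flatConst * flatBump s := continuous_const.mul continuous_flatBump
  exact intervalIntegral.integral_hasDerivAt_right (hc.intervalIntegrable _ _)
    hc.stronglyMeasurable.stronglyMeasurableAtFilter hc.continuousAt

lemma deriv_flatLift : deriv flatLift = fun t => flatConst * flatBump t :=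
  funext fun t => (hasDerivAt_flatLift t).deriv

lemma contDiff_deriv_flatLift {n : ℕ∞} : ContDiff ℝ n (deriv flatLift) := by
  rw [deriv_flatLift]; exact contDiff_const.mul contDiff_flatBump

lemma contDiff_flatLift : ContDiff ℝ ∞ flatLift :=
  contDiff_infty_iff_deriv.2
    ⟨fun t => (hasDerivAt_flatLift t).differentiableAt, contDiff_deriv_flatLift⟩

lemma flatLift_zero : flatLift 0 = 0 := intervalIntegral.integral_same

lemma intervalIntegrable_flat (a b : ℝ) :
    IntervalIntegrable (fun s => flatConst * flatBump s) volume a b :=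
  (continuous_const.mul continuous_flatBump).intervalIntegrable _ _

lemma flatLift_sub (a b : ℝ) : flatLift b - flatLift a = ∫ s in a..b, flatConst * flatBump s :=
  intervalIntegral.integral_interval_sub_left (intervalIntegrable_flat _ _)
    (intervalIntegrable_flat _ _)

lemma strictMono_flatLift : StrictMono flatLift := by
  intro a b hab
  rw [← sub_pos, flatLift_sub, intervalIntegral.integral_const_mul]
  exact mul_pos flatConst_pos (integral_flatBump_pos hab)

lemma flatLift_two_pi : flatLift (2 * Real.pi) = 2 * Real.pi := by
  rw [flatLift, intervalIntegral.integral_const_mul, flatConst,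
    div_mul_cancel₀ _ (integral_flatBump_pos Real.two_pi_pos).ne']

lemma flatLift_add_two_pi (t : ℝ) : flatLift (t + 2 * Real.pi) = flatLift t + 2 * Real.pi := by
  have hp : Function.Periodic (fun s => flatConst * flatBump s) (2 * Real.pi) := by
    intro s; simp only [flatBump_add_two_pi]
  have h := flatLift_sub t (t + 2 * Real.pi)
  rw [hp.intervalIntegral_add_eq t 0, zero_add] at h
  have h2 := flatLift_two_pi
  rw [flatLift] at h2
  linarith

lemma flatLift_neg (t : ℝ) : flatLift (-t) = -flatLift t := by
  have h := intervalIntegral.integral_comp_neg (a := 0) (b := t) (fun s => flatConst * flatBump s)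
  simp only [flatBump_neg, neg_zero] at h
  rw [flatLift, intervalIntegral.integral_symm, ← h]
  rfl

lemma isCircleLift_flatLift : IsCircleLift flatLift :=
  ⟨by exact_mod_cast contDiff_infty.1 contDiff_flatLift 2, strictMono_flatLift, flatLift_add_two_pi⟩

lemma log_deriv_flatLift_le {t : ℝ} (ht : t ∈ Ioo 0 (2 * Real.pi)) :
    Real.log (deriv flatLift t) ≤ Real.log flatConst - t⁻¹ := by
  have hs := sin_half_pos ht
  have ht0 := ht.1
  rw [deriv_flatLift]
  simp only
  rw [flatBump_eq ht, Real.log_mul flatConst_pos.ne' (Real.exp_pos _).ne', Real.log_exp]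
  have h1 : Real.sin (t / 2) ≤ t := (Real.sin_le (by linarith)).trans (by linarith)
  have h2 := inv_anti₀ hs h1
  linarith

lemma abs_flatLift_le (n : ℕ) {t : ℝ} (ht : |t| ≤ 1) :
    |flatLift t| ≤ flatConst * n.factorial * |t| ^ n := by
  have hc := flatConst_pos
  have h := intervalIntegral.norm_integral_le_of_norm_le_const (a := 0) (b := t)
    (f := fun s => flatConst * flatBump s) (C := flatConst * (n.factorial * |t| ^ n)) (by
      intro s hs
      rw [Real.norm_of_nonneg (mul_nonneg hc.le (flatBump_nonneg s))]
      have hst : |s| ≤ |t| := by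
        simpa using abs_sub_left_of_mem_uIcc (uIoc_subset_uIcc hs)
      refine mul_le_mul_of_nonneg_left ((flatBump_le n s).trans ?_) hc.le
      gcongr)
  rw [sub_zero] at h
  refine h.trans ?_
  rw [← mul_assoc]
  exact mul_le_of_le_one_right (by positivity) ht

lemma flatLift_isBigO (n : ℕ) :
    (fun t : ℝ => Complex.exp (flatLift t * Complex.I) - 1) =O[𝓝 0] fun t => t ^ n := by
  refine IsBigO.of_bound (flatConst * n.factorial) ?_
  filter_upwards [Metric.closedBall_mem_nhds (0 : ℝ) one_pos] with t ht
  have h1 : |t| ≤ 1 := by simpa using ht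
  rw [norm_pow, Real.norm_eq_abs]
  refine le_trans ?_ (abs_flatLift_le n h1)
  rw [mul_comm]
  exact Real.norm_exp_I_mul_ofReal_sub_one_le

lemma norm_exp_sub_exp_sq (a b : ℝ) :
    ‖(Circle.exp a : ℂ) - Circle.exp b‖ ^ 2 = 2 * (1 - Real.cos (a - b)) := by
  rw [← Complex.normSq_eq_norm_sq, Circle.coe_exp, Circle.coe_exp, Complex.normSq_apply]
  simp only [Complex.sub_re, Complex.sub_im, Complex.exp_ofReal_mul_I_re,
    Complex.exp_ofReal_mul_I_im, Real.cos_sub]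
  nlinarith [Real.sin_sq_add_cos_sq a, Real.sin_sq_add_cos_sq b]

lemma enorm_div_sq_eq (a b c d : ℝ) :
    ‖((Circle.exp a : ℂ) - Circle.exp b) / ((Circle.exp c : ℂ) - Circle.exp d)‖ₑ ^ 2 =
      ENNReal.ofReal ((1 - Real.cos (a - b)) / (1 - Real.cos (c - d))) := by
  rw [← ofReal_norm, ← ENNReal.ofReal_pow (norm_nonneg _), norm_div, div_pow,
    norm_exp_sub_exp_sq, norm_exp_sub_exp_sq, mul_div_mul_left _ _ two_ne_zero]

/-- Comparison of chords with arcs. -/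
lemma one_sub_cos_div_le {x y : ℝ} (hy : |y| ≤ Real.pi) :
    (1 - Real.cos x) / (1 - Real.cos y) ≤ Real.pi ^ 2 / 4 * (x / y) ^ 2 := by
  rcases eq_or_ne y 0 with rfl | hy0
  · simp
  have h1 := Real.one_sub_sq_div_two_le_cos (x := x)
  have h2 := sq_le_one_sub_cos hy
  have hy2 : 0 < y ^ 2 := by positivity
  have hpi := Real.pi_pos
  have h3 : 0 < 1 - Real.cos y := by
    by_contra! h
    have : Real.pi ^ 2 / 2 * (1 - Real.cos y) ≤ 0 := mul_nonpos_of_nonneg_of_nonpos (by positivity) h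
    linarith
  rw [div_pow, div_le_iff₀ h3]
  calc 1 - Real.cos x ≤ x ^ 2 / 2 := by linarith
    _ = x ^ 2 / y ^ 2 / 2 * y ^ 2 := by field_simp
    _ ≤ x ^ 2 / y ^ 2 / 2 * (Real.pi ^ 2 / 2 * (1 - Real.cos y)) := by gcongr
    _ = _ := by ring

/-- The convexity of `1 / sin (t / 2)`, in the form used for log-concavity of the density. -/
lemma inv_sin_half_add_le {x y s : ℝ} (hx : x ∈ Ioo 0 (2 * Real.pi)) (hy : y ∈ Ioo 0 (2 * Real.pi))
    (hs : s ∈ Icc y x) :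
    (Real.sin (s / 2))⁻¹ + (Real.sin ((x + y - s) / 2))⁻¹ ≤
      (Real.sin (x / 2))⁻¹ + (Real.sin (y / 2))⁻¹ := by
  rcases hs.1.trans hs.2 |>.lt_or_eq with hxy | rfl
  · have ha := sin_half_pos hx
    have hb := sin_half_pos hy
    have key : ∀ l m : ℝ, 0 ≤ l → 0 ≤ m → l + m = 1 →
        (Real.sin ((l * x + m * y) / 2))⁻¹ ≤
          l * (Real.sin (x / 2))⁻¹ + m * (Real.sin (y / 2))⁻¹ := by
      intro l m hl hm hlm
      have hconc := strictConcaveOn_sin_Icc.concaveOn.2 (x := x / 2) (y := y / 2)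
        ⟨by linarith [hx.1], by linarith [hx.2]⟩ ⟨by linarith [hy.1], by linarith [hy.2]⟩ hl hm hlm
      simp only [smul_eq_mul] at hconc
      rw [show l * (x / 2) + m * (y / 2) = (l * x + m * y) / 2 by ring] at hconc
      have hconv := (convexOn_zpow (-1)).2 (x := Real.sin (x / 2)) (y := Real.sin (y / 2)) ha hb
        hl hm hlm
      simp only [smul_eq_mul, zpow_neg_one] at hconv
      refine le_trans (inv_anti₀ ?_ hconc) hconv
      rcases hl.eq_or_lt with rfl | hl
      · have : m = 1 := by linarith
        rw [this]; simpa using hb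
      · positivity
    set l := (s - y) / (x - y)
    have hd : 0 < x - y := by linarith
    have hl0 : 0 ≤ l := div_nonneg (by linarith [hs.1]) hd.le
    have hl1 : l ≤ 1 := by rw [div_le_one hd]; linarith [hs.2]
    have hls : l * (x - y) = s - y := div_mul_cancel₀ _ hd.ne'
    have k1 := key l (1 - l) hl0 (by linarith) (by ring)
    have k2 := key (1 - l) l (by linarith) hl0 (by ring)
    rw [show l * x + (1 - l) * y = s by linarith] at k1
    rw [show (1 - l) * x + l * y = x + y - s by linarith] at k2
    linarith
  · have : s = y := le_antisymm hs.2 hs.1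
    rw [this, add_sub_cancel_right]

/-- The density of the lift. -/
lemma deriv_flatLift_eq {t : ℝ} (ht : t ∈ Ioo 0 (2 * Real.pi)) :
    deriv flatLift t = flatConst * Real.exp (-(Real.sin (t / 2))⁻¹) := by
  rw [deriv_flatLift]; simp only [flatBump_eq ht]

lemma deriv_flatLift_pos {t : ℝ} (ht : t ∈ Ioo 0 (2 * Real.pi)) : 0 < deriv flatLift t := by
  rw [deriv_flatLift_eq ht]; exact mul_pos flatConst_pos (Real.exp_pos _)

lemma continuous_deriv_flatLift : Continuous (deriv flatLift) :=
  (contDiff_deriv_flatLift (n := 0)).continuous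

lemma flatLift_sub_eq (a b : ℝ) : flatLift b - flatLift a = ∫ s in a..b, deriv flatLift s := by
  rw [flatLift_sub, deriv_flatLift]

/-- Difference quotients of the lift are bounded below by the geometric mean of the derivatives,
since the derivative is log-concave. -/
lemma sq_mul_deriv_mul_deriv_le {x y : ℝ} (hx : x ∈ Ioo 0 (2 * Real.pi))
    (hy : y ∈ Ioo 0 (2 * Real.pi)) :
    (x - y) ^ 2 * (deriv flatLift x * deriv flatLift y) ≤ (flatLift x - flatLift y) ^ 2 := by
  wlog hxy : y ≤ x generalizing x y
  · have := this hy hx (le_of_not_ge hxy)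
    rw [mul_comm (deriv flatLift y)] at this
    linarith [this, sq_nonneg (x - y), show (y - x) ^ 2 = (x - y) ^ 2 by ring,
      show (flatLift y - flatLift x) ^ 2 = (flatLift x - flatLift y) ^ 2 by ring,
      show (y - x) ^ 2 * (deriv flatLift x * deriv flatLift y) =
        (x - y) ^ 2 * (deriv flatLift x * deriv flatLift y) by ring]
  have hc := continuous_deriv_flatLift
  set q := deriv flatLift x * deriv flatLift y
  have hq : 0 < q := mul_pos (deriv_flatLift_pos hx) (deriv_flatLift_pos hy)
  have hpt : ∀ s ∈ Icc y x, 2 * Real.sqrt q ≤ deriv flatLift s + deriv flatLift (x + y - s) := by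
    intro s hs
    have hs1 : s ∈ Ioo 0 (2 * Real.pi) := ⟨hy.1.trans_le hs.1, hs.2.trans_lt hx.2⟩
    have hs2 : x + y - s ∈ Ioo 0 (2 * Real.pi) :=
      ⟨by linarith [hs.2, hy.1], by linarith [hs.1, hx.2]⟩
    have h1 : q ≤ deriv flatLift s * deriv flatLift (x + y - s) := by
      simp only [q]
      rw [deriv_flatLift_eq hx, deriv_flatLift_eq hy, deriv_flatLift_eq hs1, deriv_flatLift_eq hs2,
        mul_mul_mul_comm, ← Real.exp_add,
        mul_mul_mul_comm flatConst (Real.exp (-(Real.sin (s / 2))⁻¹)), ← Real.exp_add]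
      have := inv_sin_half_add_le hx hy hs
      have h3 := flatConst_pos
      gcongr ?_ * Real.exp ?_
      linarith
    have p1 := deriv_flatLift_pos hs1
    have p2 := deriv_flatLift_pos hs2
    have h2 : Real.sqrt q ^ 2 = q := Real.sq_sqrt hq.le
    refine (pow_le_pow_iff_left₀ (by positivity) (by positivity) two_ne_zero).1 ?_
    nlinarith [sq_nonneg (deriv flatLift s - deriv flatLift (x + y - s))]
  have h1 := intervalIntegral.integral_mono_on hxy (μ := volume)
    (continuous_const.intervalIntegrable _ _)
    (Continuous.intervalIntegrable (by fun_prop) _ _) hpt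
  have h2 := intervalIntegral.integral_comp_sub_left (a := y) (b := x) (deriv flatLift) (x + y)
  rw [add_sub_cancel_left, add_sub_cancel_right] at h2
  rw [intervalIntegral.integral_const, intervalIntegral.integral_add
    (hc.intervalIntegrable _ _) (Continuous.intervalIntegrable (by fun_prop) _ _), h2,
    ← flatLift_sub_eq, smul_eq_mul] at h1
  have h3 : (x - y) * Real.sqrt q ≤ flatLift x - flatLift y := by linarith
  have h4 : 0 ≤ (x - y) * Real.sqrt q := mul_nonneg (by linarith) (Real.sqrt_nonneg _)
  calc (x - y) ^ 2 * q = ((x - y) * Real.sqrt q) ^ 2 := by rw [mul_pow, Real.sq_sqrt hq.le]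
    _ ≤ _ := by gcongr

lemma sin_half_sq_mul_deriv_le {x : ℝ} (hx : x ∈ Ioo 0 (2 * Real.pi)) :
    Real.sin (x / 2) ^ 2 * deriv flatLift x ≤ 2 * flatLift x := by
  have hsub : ∀ t ∈ Ioo 0 x, t ∈ Ioo 0 (2 * Real.pi) := fun t ht => ⟨ht.1, ht.2.trans hx.2⟩
  set W : ℝ → ℝ := fun t => 2 * flatLift t - Real.sin (t / 2) ^ 2 * deriv flatLift t
  have hc := continuous_deriv_flatLift
  have hcu := contDiff_flatLift.continuous
  have hW : ∀ t ∈ Ioo 0 x, HasDerivAt W (2 * deriv flatLift t -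
      (2 * Real.sin (t / 2) ^ 1 * (Real.cos (t / 2) * (1 / 2)) * deriv flatLift t +
        Real.sin (t / 2) ^ 2 * (deriv flatLift t *
          (Real.cos (t / 2) * (1 / 2) / Real.sin (t / 2) ^ 2)))) t := by
    intro t ht
    have hs := sin_half_pos (hsub t ht)
    have d0 : HasDerivAt (fun t : ℝ => Real.sin (t / 2)) (Real.cos (t / 2) * (1 / 2)) t :=
      ((hasDerivAt_id t).div_const 2).sin
    have d1 : HasDerivAt (deriv flatLift) (deriv flatLift t *
        (Real.cos (t / 2) * (1 / 2) / Real.sin (t / 2) ^ 2)) t := by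
      have e := ((d0.fun_inv hs.ne').fun_neg.exp.const_mul flatConst)
      have e2 : deriv flatLift =ᶠ[𝓝 t]
          fun t => flatConst * Real.exp (-(Real.sin (t / 2))⁻¹) := by
        filter_upwards [Ioo_mem_nhds (hsub t ht).1 (hsub t ht).2] with w hw
        exact deriv_flatLift_eq hw
      have e3 := e.congr_of_eventuallyEq e2
      rw [deriv_flatLift_eq (hsub t ht)]
      exact e3.congr_deriv (by ring)
    have d2 := (contDiff_flatLift.differentiable (by simp) t).hasDerivAt.const_mul 2
    exact d2.sub ((d0.fun_pow 2).mul d1)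
  have hmono : MonotoneOn W (Icc 0 x) := by
    refine monotoneOn_of_hasDerivWithinAt_nonneg (convex_Icc 0 x)
      (Continuous.continuousOn (by fun_prop))
      (fun t ht => (hW t (by simpa using ht)).hasDerivWithinAt) fun t ht => ?_
    rw [interior_Icc] at ht
    have hs := sin_half_pos (hsub t ht)
    have hp := deriv_flatLift_pos (hsub t ht)
    have e : 2 * deriv flatLift t -
      (2 * Real.sin (t / 2) ^ 1 * (Real.cos (t / 2) * (1 / 2)) * deriv flatLift t +
        Real.sin (t / 2) ^ 2 * (deriv flatLift t *
          (Real.cos (t / 2) * (1 / 2) / Real.sin (t / 2) ^ 2))) =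
      deriv flatLift t * (2 - Real.sin (t / 2) * Real.cos (t / 2) - Real.cos (t / 2) / 2) := by
      field_simp
      ring
    rw [e]
    refine mul_nonneg hp.le ?_
    nlinarith [Real.sin_sq_add_cos_sq (t / 2), Real.cos_le_one (t / 2),
      sq_nonneg (Real.sin (t / 2) - Real.cos (t / 2))]
  have := hmono (left_mem_Icc.2 hx.1.le) (right_mem_Icc.2 hx.1.le) hx.1.le
  simp only [W, flatLift_zero, zero_div, Real.sin_zero] at this
  linarith

lemma flatLift_two_pi_sub (t : ℝ) : flatLift (2 * Real.pi - t) = 2 * Real.pi - flatLift t := by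
  rw [show 2 * Real.pi - t = -t + 2 * Real.pi by ring, flatLift_add_two_pi, flatLift_neg]
  ring

lemma deriv_flatLift_two_pi_sub (t : ℝ) : deriv flatLift (2 * Real.pi - t) = deriv flatLift t := by
  rw [deriv_flatLift]
  simp only
  rw [show 2 * Real.pi - t = -t + 2 * Real.pi by ring, flatBump_add_two_pi, flatBump_neg]

lemma exists_sq_mul_deriv_flatLift_le : ∃ C, 0 ≤ C ∧ ∀ x ∈ Ioo 0 (2 * Real.pi),
    x ^ 2 * deriv flatLift x ≤ C * flatLift x := by
  have hpi := Real.pi_pos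
  have hc := flatConst_pos
  refine ⟨2 * Real.pi ^ 2 + 4 * Real.pi * flatConst, by positivity, fun x hx => ?_⟩
  have hg := deriv_flatLift_pos hx
  have hx0 := hx.1
  have hu : 0 < flatLift x := by rw [← flatLift_zero]; exact strictMono_flatLift hx.1
  rcases le_total x Real.pi with h | h
  · have h1 : x / Real.pi ≤ Real.sin (x / 2) := by
      have := Real.mul_le_sin (x := x / 2) (by linarith) (by linarith)
      calc x / Real.pi = 2 / Real.pi * (x / 2) := by ring
        _ ≤ _ := this
    have h2 := sin_half_sq_mul_deriv_le hx
    have h3 : x ^ 2 ≤ Real.pi ^ 2 * Real.sin (x / 2) ^ 2 := by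
      rw [← mul_pow]
      have : x ≤ Real.pi * Real.sin (x / 2) := by rwa [div_le_iff₀' hpi] at h1
      gcongr
    calc x ^ 2 * deriv flatLift x ≤ Real.pi ^ 2 * Real.sin (x / 2) ^ 2 * deriv flatLift x := by
          gcongr
      _ ≤ Real.pi ^ 2 * (2 * flatLift x) := by rw [mul_assoc]; gcongr
      _ ≤ _ := by
        have : 0 ≤ 4 * Real.pi * flatConst * flatLift x := by positivity
        linarith
  · have h1 : Real.pi ≤ flatLift x := by
      have h2 := flatLift_two_pi_sub Real.pi
      rw [show 2 * Real.pi - Real.pi = Real.pi by ring] at h2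
      have := strictMono_flatLift.monotone h
      linarith
    have h2 : deriv flatLift x ≤ flatConst := by
      rw [deriv_flatLift_eq hx]
      refine mul_le_of_le_one_right hc.le (Real.exp_le_one_iff.2 ?_)
      have := sin_half_pos hx
      rw [neg_nonpos]; positivity
    calc x ^ 2 * deriv flatLift x ≤ (2 * Real.pi) ^ 2 * flatConst := by
          gcongr; exact hx.2.le
      _ = 4 * Real.pi * flatConst * Real.pi := by ring
      _ ≤ 4 * Real.pi * flatConst * flatLift x := by gcongr
      _ ≤ _ := by
        have : 0 ≤ 2 * Real.pi ^ 2 * flatLift x := by positivity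
        linarith

/-- The inverse of `flatLift`. -/
noncomputable def flatInv : ℝ → ℝ :=
  (StrictMono.orderIsoOfSurjective flatLift strictMono_flatLift
    isCircleLift_flatLift.surjective).symm

lemma rightInverse_flatInv : Function.RightInverse flatInv flatLift := fun s =>
  (StrictMono.orderIsoOfSurjective flatLift strictMono_flatLift
    isCircleLift_flatLift.surjective).apply_symm_apply s

lemma flatLift_flatInv (s : ℝ) : flatLift (flatInv s) = s := rightInverse_flatInv s

lemma flatInv_eq {s t : ℝ} (h : flatLift t = s) : flatInv s = t :=
  strictMono_flatLift.injective (by rw [flatLift_flatInv, h])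

lemma continuous_flatInv : Continuous flatInv :=
  (StrictMono.orderIsoOfSurjective flatLift strictMono_flatLift
    isCircleLift_flatLift.surjective).symm.continuous

lemma strictMono_flatInv : StrictMono flatInv :=
  (StrictMono.orderIsoOfSurjective flatLift strictMono_flatLift
    isCircleLift_flatLift.surjective).symm.strictMono

lemma flatInv_zero : flatInv 0 = 0 := flatInv_eq flatLift_zero

lemma flatInv_two_pi : flatInv (2 * Real.pi) = 2 * Real.pi := flatInv_eq flatLift_two_pi

lemma flatInv_two_pi_sub (s : ℝ) : flatInv (2 * Real.pi - s) = 2 * Real.pi - flatInv s :=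
  flatInv_eq (by rw [flatLift_two_pi_sub, flatLift_flatInv])

lemma flatInv_mem_Ioo {s : ℝ} (hs : s ∈ Ioo 0 (2 * Real.pi)) :
    flatInv s ∈ Ioo 0 (2 * Real.pi) := by
  constructor
  · rw [← flatInv_zero]; exact strictMono_flatInv hs.1
  · rw [← flatInv_two_pi]; exact strictMono_flatInv hs.2

lemma hasDerivAt_flatInv {s : ℝ} (hs : s ∈ Ioo 0 (2 * Real.pi)) :
    HasDerivAt flatInv (deriv flatLift (flatInv s))⁻¹ s :=
  HasDerivAt.of_local_left_inverse continuous_flatInv.continuousAt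
    (contDiff_flatLift.differentiable (by simp) _).hasDerivAt
    (deriv_flatLift_pos (flatInv_mem_Ioo hs)).ne' (Filter.Eventually.of_forall flatLift_flatInv)

lemma deriv_flatInv {s : ℝ} (hs : s ∈ Ioo 0 (2 * Real.pi)) :
    deriv flatInv s = (deriv flatLift (flatInv s))⁻¹ := (hasDerivAt_flatInv hs).deriv

lemma two_pi_sub_mem_Ioo {s : ℝ} (hs : s ∈ Ioo 0 (2 * Real.pi)) :
    2 * Real.pi - s ∈ Ioo 0 (2 * Real.pi) := ⟨by linarith [hs.2], by linarith [hs.1]⟩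

lemma deriv_flatInv_two_pi_sub {s : ℝ} (hs : s ∈ Ioo 0 (2 * Real.pi)) :
    deriv flatInv (2 * Real.pi - s) = deriv flatInv s := by
  rw [deriv_flatInv hs, deriv_flatInv (two_pi_sub_mem_Ioo hs), flatInv_two_pi_sub,
    deriv_flatLift_two_pi_sub]

lemma deriv_flatInv_pos {s : ℝ} (hs : s ∈ Ioo 0 (2 * Real.pi)) : 0 < deriv flatInv s := by
  rw [deriv_flatInv hs]; exact inv_pos.2 (deriv_flatLift_pos (flatInv_mem_Ioo hs))

lemma integrableOn_deriv_flatInv : IntegrableOn (deriv flatInv) (Ioo 0 (2 * Real.pi)) := by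
  refine (intervalIntegral.integrableOn_deriv_of_nonneg (g := flatInv)
    continuous_flatInv.continuousOn
    (fun s hs => ?_) (fun s hs => (deriv_flatInv_pos hs).le)).mono_set Ioo_subset_Ioc_self
  rw [deriv_flatInv hs]; exact hasDerivAt_flatInv hs

lemma flatInv_sub_sq_le {s t : ℝ} (hs : s ∈ Ioo 0 (2 * Real.pi)) (ht : t ∈ Ioo 0 (2 * Real.pi)) :
    (flatInv s - flatInv t) ^ 2 ≤ (s - t) ^ 2 * (deriv flatInv s * deriv flatInv t) := by
  have h := sq_mul_deriv_mul_deriv_le (flatInv_mem_Ioo hs) (flatInv_mem_Ioo ht)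
  rw [flatLift_flatInv, flatLift_flatInv] at h
  have p1 := deriv_flatLift_pos (flatInv_mem_Ioo hs)
  have p2 := deriv_flatLift_pos (flatInv_mem_Ioo ht)
  rw [deriv_flatInv hs, deriv_flatInv ht, ← mul_inv, ← div_eq_mul_inv, le_div_iff₀ (by positivity)]
  exact h

lemma exists_flatInv_sq_le : ∃ C, 0 ≤ C ∧ ∀ s ∈ Ioo 0 (2 * Real.pi),
    flatInv s ^ 2 / s ^ 2 * s ≤ C * deriv flatInv s := by
  obtain ⟨C, hC, h⟩ := exists_sq_mul_deriv_flatLift_le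
  refine ⟨C, hC, fun s hs => ?_⟩
  have h1 := h _ (flatInv_mem_Ioo hs)
  have p1 := deriv_flatLift_pos (flatInv_mem_Ioo hs)
  have hs0 := hs.1
  rw [flatLift_flatInv] at h1
  rw [deriv_flatInv hs, ← div_eq_mul_inv, le_div_iff₀ p1]
  calc flatInv s ^ 2 / s ^ 2 * s * deriv flatLift (flatInv s)
      = flatInv s ^ 2 * deriv flatLift (flatInv s) / s := by field_simp
    _ ≤ C := by rwa [div_le_iff₀ hs0]

/-- The square of the slope of a chord of the inverse lift at the origin, up to a constant. -/
noncomputable def cornerSlope (s : ℝ) : ℝ := Real.pi ^ 2 * (flatInv s ^ 2 / s ^ 2)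

lemma measurable_cornerSlope : Measurable cornerSlope := by
  have := continuous_flatInv.measurable
  unfold cornerSlope
  fun_prop

/-- A majorant for the Douglas integrand of the inverse near the corner `(0, 2π)`. -/
noncomputable def cornerBound (p : ℝ × ℝ) : ℝ≥0∞ :=
  {p : ℝ × ℝ | 2 * Real.pi ≤ p.1 + p.2}.indicator (fun p => ENNReal.ofReal (cornerSlope p.1)) p +
  {p : ℝ × ℝ | p.1 + p.2 ≤ 2 * Real.pi}.indicator
    (fun p => ENNReal.ofReal (cornerSlope (2 * Real.pi - p.1))) p

lemma measurable_cornerBound : Measurable cornerBound := by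
  have h := measurable_cornerSlope
  refine Measurable.add (Measurable.indicator (by fun_prop) ?_)
    (Measurable.indicator (by fun_prop) ?_)
  · exact measurableSet_le measurable_const (by fun_prop)
  · exact measurableSet_le (by fun_prop) measurable_const

lemma corner_le {x y : ℝ} (hx : 0 < x) (hxy : x ≤ y) (hy : x + y ≤ Real.pi) :
    (1 - Real.cos (flatInv x + flatInv y)) / (1 - Real.cos (x + y)) ≤ cornerSlope y := by
  have h0 : 0 < flatInv x := by rw [← flatInv_zero]; exact strictMono_flatInv hx
  have h1 := strictMono_flatInv.monotone hxy
  have h2 := h0.trans_le h1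
  have hy0 : 0 < y := hx.trans_le hxy
  refine (one_sub_cos_div_le (by rw [abs_of_pos (by linarith)]; exact hy)).trans ?_
  calc Real.pi ^ 2 / 4 * ((flatInv x + flatInv y) / (x + y)) ^ 2
      ≤ Real.pi ^ 2 / 4 * ((flatInv y + flatInv y) / y) ^ 2 := by
        gcongr
        linarith
    _ = cornerSlope y := by unfold cornerSlope; field_simp; ring

lemma ofReal_le_cornerBound {s t : ℝ} (hs : s ∈ Ioo 0 (2 * Real.pi)) (ht : t ∈ Ioo 0 (2 * Real.pi))
    (hst : Real.pi < s - t) :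
    ENNReal.ofReal ((1 - Real.cos (flatInv s - flatInv t)) / (1 - Real.cos (s - t))) ≤
      cornerBound (s, t) + cornerBound (t, s) := by
  have e1 : Real.cos (s - t) = Real.cos (2 * Real.pi - s + t) := by
    rw [← Real.cos_two_pi_sub]; ring_nf
  have e2 : Real.cos (flatInv s - flatInv t) =
      Real.cos (flatInv (2 * Real.pi - s) + flatInv t) := by
    rw [flatInv_two_pi_sub, ← Real.cos_two_pi_sub]; ring_nf
  rw [e1, e2]
  have hs' := two_pi_sub_mem_Ioo hs
  rcases le_total (2 * Real.pi) (s + t) with h | h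
  · refine le_trans (ENNReal.ofReal_le_ofReal (corner_le hs'.1 (by linarith) (by linarith))) ?_
    refine le_trans ?_ le_add_self
    refine le_trans ?_ le_self_add
    rw [indicator_of_mem (by simpa [add_comm] using h)]
  · rw [add_comm (flatInv _), add_comm (2 * Real.pi - s)]
    refine le_trans (ENNReal.ofReal_le_ofReal (corner_le ht.1 (by linarith) (by linarith))) ?_
    refine le_trans ?_ le_self_add
    refine le_trans ?_ le_add_self
    rw [indicator_of_mem (by simpa using h)]

lemma inverse_douglas_le {s t : ℝ} (hs : s ∈ Ioo 0 (2 * Real.pi)) (ht : t ∈ Ioo 0 (2 * Real.pi)) :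
    ENNReal.ofReal ((1 - Real.cos (flatInv s - flatInv t)) / (1 - Real.cos (s - t))) ≤
      ENNReal.ofReal (Real.pi ^ 2 / 4 * deriv flatInv s) * ENNReal.ofReal (deriv flatInv t) +
        (cornerBound (s, t) + cornerBound (t, s)) := by
  rcases le_or_gt |s - t| Real.pi with h | h
  · refine le_trans ?_ le_self_add
    have p1 := deriv_flatInv_pos hs
    have p2 := deriv_flatInv_pos ht
    rw [← ENNReal.ofReal_mul (by positivity)]
    refine ENNReal.ofReal_le_ofReal ((one_sub_cos_div_le h).trans ?_)
    rw [mul_assoc]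
    gcongr
    rw [div_pow]
    exact div_le_of_le_mul₀ (sq_nonneg _) (by positivity)
      (by rw [mul_comm]; exact flatInv_sub_sq_le hs ht)
  · refine le_trans ?_ le_add_self
    rcases lt_abs.1 h with h | h
    · exact ofReal_le_cornerBound hs ht h
    · rw [add_comm, ← Real.cos_neg (s - t), ← Real.cos_neg (flatInv s - flatInv t), neg_sub,
        neg_sub]
      exact ofReal_le_cornerBound ht hs (by linarith)

lemma exists_lintegral_cornerBound_le : ∃ C, 0 ≤ C ∧ ∀ s ∈ Ioo 0 (2 * Real.pi),
    ∫⁻ t in Ioo 0 (2 * Real.pi), cornerBound (s, t) ≤ ENNReal.ofReal (C * deriv flatInv s) := by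
  obtain ⟨C, hC, h⟩ := exists_flatInv_sq_le
  have key : ∀ s ∈ Ioo 0 (2 * Real.pi), ENNReal.ofReal (cornerSlope s) * ENNReal.ofReal s ≤
      ENNReal.ofReal (Real.pi ^ 2 * C * deriv flatInv s) := fun s hs => by
    rw [← ENNReal.ofReal_mul' hs.1.le, cornerSlope, mul_assoc, mul_assoc]
    have := h s hs
    exact ENNReal.ofReal_le_ofReal (by gcongr)
  refine ⟨2 * (Real.pi ^ 2 * C), by positivity, fun s hs => ?_⟩
  have hs' := two_pi_sub_mem_Ioo hs
  have k1 := key s hs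
  have k2 := key _ hs'
  rw [deriv_flatInv_two_pi_sub hs] at k2
  have p1 := deriv_flatInv_pos hs
  have hle : ∀ t ∈ Ioo 0 (2 * Real.pi), cornerBound (s, t) ≤
      (Icc (2 * Real.pi - s) (2 * Real.pi)).indicator
        (fun _ => ENNReal.ofReal (cornerSlope s)) t +
      (Icc 0 (2 * Real.pi - s)).indicator
        (fun _ => ENNReal.ofReal (cornerSlope (2 * Real.pi - s))) t := by
    intro t ht
    refine add_le_add ?_ ?_
    · by_cases hm : 2 * Real.pi ≤ s + t
      · rw [indicator_of_mem (by simpa using hm), indicator_of_mem (mem_Icc.2 ⟨by linarith, ht.2.le⟩)]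
      · rw [indicator_of_notMem (by simpa using hm)]; exact bot_le
    · by_cases hm : s + t ≤ 2 * Real.pi
      · rw [indicator_of_mem (by simpa using hm), indicator_of_mem (mem_Icc.2 ⟨ht.1.le, by linarith⟩)]
      · rw [indicator_of_notMem (by simpa using hm)]; exact bot_le
  calc ∫⁻ t in Ioo 0 (2 * Real.pi), cornerBound (s, t)
      ≤ ∫⁻ t in Ioo 0 (2 * Real.pi), ((Icc (2 * Real.pi - s) (2 * Real.pi)).indicator
        (fun _ => ENNReal.ofReal (cornerSlope s)) t + (Icc 0 (2 * Real.pi - s)).indicator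
        (fun _ => ENNReal.ofReal (cornerSlope (2 * Real.pi - s))) t) :=
        setLIntegral_mono' measurableSet_Ioo hle
    _ ≤ ∫⁻ t, ((Icc (2 * Real.pi - s) (2 * Real.pi)).indicator
        (fun _ => ENNReal.ofReal (cornerSlope s)) t + (Icc 0 (2 * Real.pi - s)).indicator
        (fun _ => ENNReal.ofReal (cornerSlope (2 * Real.pi - s))) t) :=
        setLIntegral_le_lintegral _ _
    _ = ENNReal.ofReal (cornerSlope s) * ENNReal.ofReal s +
        ENNReal.ofReal (cornerSlope (2 * Real.pi - s)) * ENNReal.ofReal (2 * Real.pi - s) := by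
        rw [lintegral_add_left (measurable_const.indicator measurableSet_Icc),
          lintegral_indicator_const measurableSet_Icc, lintegral_indicator_const measurableSet_Icc,
          Real.volume_Icc, Real.volume_Icc, sub_sub_cancel, sub_zero]
    _ ≤ _ := by
        rw [mul_assoc, two_mul (Real.pi ^ 2 * C * _), ENNReal.ofReal_add (by positivity) (by positivity)]
        exact add_le_add k1 k2

/-- The homeomorphism induced by `flatLift` satisfies the bi-Douglas condition. -/
theorem biDouglas_flatLift : BiDouglas isCircleLift_flatLift.circleHomeo := by
  obtain ⟨K, hK, hKle⟩ := isCircleLift_flatLift.exists_one_sub_cos_le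
  obtain ⟨C, hC, hCle⟩ := exists_lintegral_cornerBound_le
  set μ : Measure ℝ := volume.restrict (Ioo 0 (2 * Real.pi)) with hμ
  have hd : Measurable (deriv flatInv) := measurable_deriv _
  have hfin : ∫⁻ s, ENNReal.ofReal (deriv flatInv s) ∂μ < ⊤ :=
    integrableOn_deriv_flatInv.lintegral_lt_top
  have hfin' : ∀ c : ℝ, 0 ≤ c → ∫⁻ s, ENNReal.ofReal (c * deriv flatInv s) ∂μ < ⊤ := fun c hc =>
    (integrableOn_deriv_flatInv.const_mul c).lintegral_lt_top
  have hT : ∫⁻ p, cornerBound p ∂(μ.prod μ) < ⊤ := by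
    rw [lintegral_prod _ measurable_cornerBound.aemeasurable]
    exact (setLIntegral_mono' measurableSet_Ioo hCle).trans_lt (hfin' C hC)
  have hT' : ∫⁻ p : ℝ × ℝ, cornerBound p.swap ∂(μ.prod μ) < ⊤ := by
    rwa [lintegral_prod_swap]
  have hT1 : ∫⁻ p : ℝ × ℝ, ENNReal.ofReal (Real.pi ^ 2 / 4 * deriv flatInv p.1) *
      ENNReal.ofReal (deriv flatInv p.2) ∂(μ.prod μ) < ⊤ := by
    rw [lintegral_prod_mul (f := fun s => ENNReal.ofReal (Real.pi ^ 2 / 4 * deriv flatInv s))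
      (g := fun s => ENNReal.ofReal (deriv flatInv s)) (by fun_prop) (by fun_prop)]
    exact ENNReal.mul_lt_top (hfin' _ (by positivity)) hfin
  have hcb := measurable_cornerBound
  have hcs : Measurable fun p : ℝ × ℝ => cornerBound p.swap := hcb.comp measurable_swap
  have hK1 : ∫⁻ _ : ℝ × ℝ, ENNReal.ofReal K ∂(μ.prod μ) < ⊤ := by
    rw [lintegral_const]
    exact ENNReal.mul_lt_top ENNReal.ofReal_lt_top (measure_lt_top _ _)
  have hG : ∫⁻ p : ℝ × ℝ, (ENNReal.ofReal K +
      (ENNReal.ofReal (Real.pi ^ 2 / 4 * deriv flatInv p.1) * ENNReal.ofReal (deriv flatInv p.2) +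
        (cornerBound p + cornerBound p.swap))) ∂(μ.prod μ) < ⊤ := by
    rw [lintegral_add_left (by fun_prop), lintegral_add_left (by fun_prop), lintegral_add_left hcb]
    exact ENNReal.add_lt_top.2 ⟨hK1, ENNReal.add_lt_top.2 ⟨hT1, ENNReal.add_lt_top.2 ⟨hT, hT'⟩⟩⟩
  rw [lintegral_prod _ (by fun_prop)] at hG
  unfold BiDouglas
  rw [Measure.restrict_congr_set (Ioo_ae_eq_Ioc (μ := volume) (a := (0 : ℝ)) (b := 2 * Real.pi)).symm]
  refine lt_of_le_of_lt ?_ hG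
  refine setLIntegral_mono' measurableSet_Ioo fun s hs =>
    setLIntegral_mono' measurableSet_Ioo fun t ht => ?_
  rw [isCircleLift_flatLift.circleHomeo_exp, isCircleLift_flatLift.circleHomeo_exp,
    isCircleLift_flatLift.circleHomeo_symm_exp rightInverse_flatInv,
    isCircleLift_flatLift.circleHomeo_symm_exp rightInverse_flatInv, enorm_div_sq_eq,
    enorm_div_sq_eq]
  refine add_le_add (ENNReal.ofReal_le_ofReal ?_) (inverse_douglas_le hs ht)
  have h := hKle t (s - t)
  rw [add_sub_cancel] at h
  exact div_le_of_le_mul₀ (by linarith [Real.cos_le_one (s - t)]) hK h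

theorem not_integrableOn_distortion_flatLift :
    ¬ IntegrableOn (distortion (poissonExt (liftMap flatLift))) (ball 0 1) := by
  obtain ⟨c, M, t₀, δ₀, hc, hM, ht₀, ht₁, hδ, hδ1, hK⟩ :=
    isCircleLift_flatLift.exists_le_distortion flatLift_neg
      (contDiff_deriv_flatLift (n := 2))
  have hsub : ∀ t ∈ Ioo 0 t₀, t ∈ Ioo 0 (2 * Real.pi) := fun t ht =>
    ⟨ht.1, by linarith [ht.2, Real.pi_gt_three]⟩
  exact not_integrableOn_of_polar_lower_bound continuous_deriv_flatLift hc hM ht₀ ht₁ hδ hδ1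
    (fun t ht => deriv_flatLift_pos (hsub t ht)) (fun t ht => log_deriv_flatLift_le (hsub t ht)) hK

theorem mainTheorem6 :
    ∃ φ : Circle ≃ₜ Circle,
      -- `φ` is smooth
      ContDiff ℝ ∞ (fun t : ℝ => (φ (Circle.exp t) : ℂ)) ∧
      -- `φ` has a flat point `exp (i θ)`
      (∃ θ : ℝ, ∀ n : ℕ,
        (fun t : ℝ => (φ (Circle.exp t) : ℂ) - φ (Circle.exp θ)) =O[𝓝 θ] fun t => (t - θ) ^ n) ∧
      BiDouglas φ ∧
      ∃ h f : ℂ → ℂ,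
        IsHarmonicExtension φ h ∧
        -- `h` is a homeomorphism of the closed disc and of the open disc, with inverse `f`
        BijOn h (closedBall 0 1) (closedBall 0 1) ∧
        BijOn h (ball 0 1) (ball 0 1) ∧
        InvOn f h (closedBall 0 1) (closedBall 0 1) ∧
        ContinuousOn f (closedBall 0 1) ∧
        -- the inverse is not in `W^{1,2}`
        ¬ MemSobolevOne 2 (ball 0 1) f ∧
        -- the distortion is defined everywhere in the disc and is not integrable
        (∀ z ∈ ball (0 : ℂ) 1, 0 < jacobianDet h z) ∧
        ¬ IntegrableOn (distortion h) (ball 0 1) := by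
  have hu := isCircleLift_flatLift
  have hb := hu.bijOn_closedBall
  have hbo := hu.bijOn_ball
  have hinv : InvOn (Function.invFunOn (poissonExt (liftMap flatLift)) (closedBall 0 1))
      (poissonExt (liftMap flatLift)) (closedBall 0 1) (closedBall 0 1) := hb.invOn_invFunOn
  have hcf := continuousOn_of_invOn (isCompact_closedBall (0 : ℂ) 1)
    hu.isHarmonicExtension.continuousOn hb hinv
  have hJ : ∀ z ∈ ball (0 : ℂ) 1, 0 < jacobianDet (poissonExt (liftMap flatLift)) z :=
    fun z hz => hu.det_fderiv_pos flatLift_neg hz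
  refine ⟨hu.circleHomeo, ?_, ⟨0, fun n => ?_⟩, biDouglas_flatLift, poissonExt (liftMap flatLift),
    _, hu.isHarmonicExtension, hb, hbo, hinv, hcf, fun hW => ?_, hJ,
    not_integrableOn_distortion_flatLift⟩
  · simp only [hu.circleHomeo_exp, Circle.coe_exp]
    exact ((Complex.ofRealCLM.contDiff.comp contDiff_flatLift).mul contDiff_const).cexp
  · have e : (hu.circleHomeo (Circle.exp 0) : ℂ) = 1 := by
      rw [hu.circleHomeo_exp, flatLift_zero, Circle.exp_zero, Circle.coe_one]
    rw [e]
    simpa only [hu.circleHomeo_exp, Circle.coe_exp, sub_zero] using flatLift_isBigO n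
  · exact not_integrableOn_distortion_flatLift (integrableOn_distortion_of_memSobolevOne hbo
      (fun z hz => (hu.contDiffAt hz).differentiableAt (by simp)) hu.continuousOn_fderiv hJ
      (hinv.1.mono ball_subset_closedBall) (hcf.mono ball_subset_closedBall) hW)
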